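/- Let $T$ be a text of $n\ge 2$ tokens, let $f(t,T)$ be the number of occurrences of a token $t$ in $T$ and $f_T=\max_{t\in T} f(t,T)$. Let $h$ be a hash function that assigns a non-negative integer $h(t,x)$ to a token $t$ and an integer $x\ge1$. A *key* is a pair $(p,q)$ with $1\le p\le q\le n$ and $T[p]=T[q]$; its hash value is $h(t,x)$, where $t=T[q]$ and $x$ is the number of occurrences of $t$ in $T[p,q]$. The key is *active* if $h(t,x)<h(t,x')$ for all $1\le x'<x$; $X(T)$ is the set of active keys. A key $(p,q)$ *dominates* $(p',q')\neq(p,q)$ if $p'\le p$ and $q\le q'$. Monotonic partitioning is the following algorithm. Step 1 generates a list $K$ of keys with their hash values: first the array $A$ of positions of every distinct token $t$ is collected, in a map kept in a balanced search tree; then *GenerateKeys* lists $(A[i],A[j],h(t,j-i+1))$ for every $t$ and all $1\le i\le j\le|A|$, whereas *GenerateActiveKeys* runs, for every $t$, through $x=1,\dots,|A|$, maintaining the smallest value $h(t,x)$ seen so far, and only if $h(t,x)$ is strictly smaller than all earlier ones lists $(A[i],A[i+x-1],h(t,x))$ for $1\le i\le|A|-x+1$. Step 2 sets $S=\{(0,0),(n+1,n+1)\}$,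 kept in lexicographic order in a self-balancing binary search tree, $S[k]$ being its $k$-th element with coordinates $S[k].x$, $S[k].y$. Step 3 visits the keys $(b,c)$ of $K$ in ascending order of hash value $v$: find by binary search the largest $j'$ with $S[j'].y\le c$; if $S[j']$ dominates $(b,c)$, skip the key; otherwise find by binary search the largest $i$ with $S[i].y<c$ and the smallest $j$ with $S[j].x>b$, put $c'=c$, and for $k=i,\dots,j-1$ put $a=S[k].x+1$, $d=S[k+1].y-1$, output the window $(v,a,b,c',d)$ if $a\le b$ and $c'\le d$, and set $c'=S[k+1].y$; then remove $S[i+1],\dots,S[j-1]$ from $S$ and insert $(b,c)$. Time is the number of elementary steps of a unit-cost random access machine (a comparison or arithmetic operation, a hash evaluation, an array access, an amortized append, or following a pointer is $O(1)$ steps); space is the peak number of memory cells in use, counting the text, all data structures, the call stack and the output. There is an absolute constant behind the following $O$'s. 1. For every $h$, the algorithm with GenerateActiveKeys takes $O(|X(T)|\log n)$ time and $O(|X(T)|)$ space. 2. If $h$ is a random hash function, i.e. almost surely no two of the values $h(t,x)$ with $t\in T$, $1\le x\le f(t,T)$ collide and the joint law of these values is invariant under permutations of the arguments $(t,x)$,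 then the algorithm with GenerateActiveKeys takes, in expectation, $O(n\log n+n\log n\log f_T)$ time and $O(n+n\log f_T)$ space. 3. For every $h$, the algorithm with GenerateKeys takes $O(n f_T\log n)$ time and $O(n f_T)$ space. -/

import Mathlib

open MeasureTheory ProbabilityTheory

namespace TextAlign

/-! ### Cost model

Unit-cost random access machine.  A value of type `Run β` is the record of one terminating
execution: its result, the number of elementary steps, the change in the number of occupied
memory cells, and the peak number of cells occupied at the same time (beyond those occupied
when it started).  A cell is a block of boundedly many machine words: a tree node, a list cell, an
array entry or the frame of a procedure call.  The programs further below touch their data only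
through the primitives of this section. -/

structure Run (β : Type) where
  val : β
  time : ℕ
  net : ℤ
  peak : ℕ

instance : Monad Run where
  pure a := ⟨a, 0, 0, 0⟩
  bind m f :=
    ⟨(f m.val).val, m.time + (f m.val).time, m.net + (f m.val).net,
      max m.peak (m.net + ((f m.val).peak : ℤ)).toNat⟩

/-- One elementary step with result `a`. -/
def step {β : Type} (a : β) : Run β := ⟨a, 1, 0, 0⟩

/-- One elementary step: a jump, or following a pointer. -/
def tick : Run Unit := step ()

/-- Occupy `k` new cells. -/
def alloc (k : ℕ) : Run Unit := ⟨(), k, k, k⟩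

/-- Release one cell. -/
def free : Run Unit := ⟨(), 1, -1, 0⟩

/-- A procedure call: its frame occupies one cell until it returns. -/
def call {β : Type} (m : Run β) : Run β := do
  alloc 1
  let r ← m
  free
  return r

def addN (a b : ℕ) : Run ℕ := step (a + b)
def subN (a b : ℕ) : Run ℕ := step (a - b)
def maxN (a b : ℕ) : Run ℕ := step (max a b)
def le {β : Type} [LinearOrder β] (a b : β) : Run Bool := step (decide (a ≤ b))
def lt {β : Type} [LinearOrder β] (a b : β) : Run Bool := step (decide (a < b))
def eq {β : Type} [LinearOrder β] (a b : β) : Run Bool := step (decide (a = b))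

/-- One evaluation of the hash function. -/
def hash {α : Type} (h : α → ℕ → ℕ) (t : α) (x : ℕ) : Run ℕ := step (h t x)

/-- Entry `i` (counted from 0) of an array. -/
def read (A : Array ℕ) (i : ℕ) : Run ℕ := step (A.getD i 0)

/-- Append an entry to a growable array, at the amortized cost of doubling its capacity when full. -/
def append (A : Array ℕ) (a : ℕ) : Run (Array ℕ) := do
  alloc 1
  step (A.push a)

/-- Add an element at the front of a linked list. -/
def cons {β : Type} (a : β) (l : List β) : Run (List β) := do
  alloc 1
  step (a :: l)

/-- `for i = lo, …, lo + cnt - 1 do s ← f i s`. -/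
def forRange {σ : Type} : ℕ → ℕ → σ → (ℕ → σ → Run σ) → Run σ
  | _, 0, s, _ => do
    tick
    return s
  | lo, cnt + 1, s, f => do
    tick
    let s' ← f lo s
    forRange (lo + 1) cnt s' f

/-- `for a in l do s ← f a s`. -/
def forList {β σ : Type} : List β → σ → (β → σ → Run σ) → Run σ
  | [], s, _ => do
    tick
    return s
  | a :: l, s, f => do
    tick
    let s' ← f a s
    forList l s' f

/-! ### A self-balancing binary search tree

Height-balanced (AVL) trees; every node also stores the size of its subtree, so that the elements
can be addressed by their index (from 0) in the in-order sequence.  Updates are done in place: the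
nodes on the search path are overwritten, and only insertion and removal of an element occupy or
release a cell. -/

inductive AVL (β : Type) where
  | nil : AVL β
  | node (l : AVL β) (a : β) (r : AVL β) (ht sz : ℕ) : AVL β

namespace AVL

variable {β : Type}

/-- The stored height. -/
def ht : AVL β → ℕ
  | nil => 0
  | node _ _ _ k _ => k

/-- The stored size. -/
def sz : AVL β → ℕ
  | nil => 0
  | node _ _ _ _ k => k

/-- Overwrite a node with new children and an element, and recompute the stored height and size. -/
def mk (l : AVL β) (a : β) (r : AVL β) : Run (AVL β) := do
  let m ← maxN l.ht r.ht
  let k ← addN m 1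
  let u ← addN l.sz r.sz
  let s ← addN u 1
  step (node l a r k s)

/-- `mk`, followed by the AVL rotation that restores balance when the heights of `l` and `r` differ
by 2. -/
def bal (l : AVL β) (a : β) (r : AVL β) : Run (AVL β) := do
  let hl ← addN l.ht 1
  let hr ← addN r.ht 1
  if ← lt hr l.ht then
    tick
    match l with
    | nil => mk l a r
    | node ll la lr _ _ =>
      if ← le lr.ht ll.ht then
        let r' ← mk lr a r
        mk ll la r'
      else
        tick
        match lr with
        | nil => mk l a r
        | node lrl lra lrr _ _ =>
          let l' ← mk ll la lrl
          let r' ← mk lrr a r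
          mk l' lra r'
  else if ← lt hl r.ht then
    tick
    match r with
    | nil => mk l a r
    | node rl ra rr _ _ =>
      if ← le rl.ht rr.ht then
        let l' ← mk l a rl
        mk l' ra rr
      else
        tick
        match rl with
        | nil => mk l a r
        | node rll rla rlr _ _ =>
          let l' ← mk l a rll
          let r' ← mk rlr ra rr
          mk l' rla r'
  else
    mk l a r

/-- Insert `x` so that it gets index `i`. -/
def insertAt : AVL β → ℕ → β → Run (AVL β)
  | nil, _, x => do
    alloc 1
    mk nil x nil
  | node l a r _ _, i, x => call do
    if ← le i l.sz then
      let l' ← insertAt l i x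
      bal l' a r
    else
      let i' ← subN i l.sz
      let i'' ← subN i' 1
      let r' ← insertAt r i'' x
      bal l a r'

/-- Remove the first element of the tree with root `a` and subtrees `l`, `r`; return it together
with the remaining tree. -/
def popMin : AVL β → β → AVL β → Run (β × AVL β)
  | nil, a, r => do
    tick
    free
    return (a, r)
  | node ll la lr _ _, a, r => call do
    let (m, l') ← popMin ll la lr
    let t ← bal l' a r
    return (m, t)

/-- Remove the element of index `i`. -/
def removeAt : AVL β → ℕ → Run (AVL β)
  | nil, _ => do
    tick
    return nil
  | node l a r _ _, i => call do
    if ← lt i l.sz then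
      let l' ← removeAt l i
      bal l' a r
    else if ← lt l.sz i then
      let i' ← subN i l.sz
      let i'' ← subN i' 1
      let r' ← removeAt r i''
      bal l a r'
    else
      tick
      match r with
      | nil => do
        free
        return l
      | node rl ra rr _ _ => do
        let (m, r') ← popMin rl ra rr
        bal l m r'

/-- The element of index `i`. -/
def get? : AVL β → ℕ → Run (Option β)
  | nil, _ => do
    tick
    return none
  | node l a r _ _, i => do
    tick
    if ← lt i l.sz then
      get? l i
    else if ← lt l.sz i then
      let i' ← subN i l.sz
      let i'' ← subN i' 1
      get? r i''
    else
      return some a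

/-- Overwrite the element of index `i`. -/
def setAt : AVL β → ℕ → β → Run (AVL β)
  | nil, _, _ => do
    tick
    return nil
  | node l a r k s, i, x => call do
    if ← lt i l.sz then
      let l' ← setAt l i x
      step (node l' a r k s)
    else if ← lt l.sz i then
      let i' ← subN i l.sz
      let i'' ← subN i' 1
      let r' ← setAt r i'' x
      step (node l a r' k s)
    else
      step (node l x r k s)

/-- Binary search: `acc` plus the number of elements satisfying `p`, for a tree in whose in-order
sequence the elements satisfying `p` precede all the others. -/
def search (p : β → Run Bool) : AVL β → ℕ → Run ℕ
  | nil, acc => do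
    tick
    return acc
  | node l a r _ _, acc => do
    tick
    if ← p a then
      let u ← addN acc l.sz
      let acc' ← addN u 1
      search p r acc'
    else
      search p l acc

/-- The in-order sequence as a linked list, in front of `acc`. -/
def toList : AVL β → List β → Run (List β)
  | nil, acc => do
    tick
    return acc
  | node l a r _ _, acc => call do
    let rest ← toList r acc
    let rest' ← cons a rest
    toList l rest'

end AVL

/-! ### The algorithms -/

/-- A key `(p, q)` with its hash value `v`. -/
structure HKey where
  p : ℕ
  q : ℕ
  v : ℕ

/-- The compact window `⟨T, h, v, a, b, c, d⟩` of the text and hash function at hand. -/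
structure Window where
  v : ℕ
  a : ℕ
  b : ℕ
  c : ℕ
  d : ℕ

variable {α : Type} [LinearOrder α]

/-- `map`: the distinct tokens in order, each with the array of its positions. -/
abbrev PosMap (α : Type) : Type := AVL (α × Array ℕ)

/-- Append `i` to `map[t]`. -/
def addPosition (map : PosMap α) (t : α) (i : ℕ) : Run (PosMap α) := do
  let k ← AVL.search (fun e => lt e.1 t) map 0
  match ← AVL.get? map k with
  | none =>
    let A ← append #[] i
    AVL.insertAt map k (t, A)
  | some (t', A) =>
    if ← eq t' t then
      let A' ← append A i
      AVL.setAt map k (t, A')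
    else
      let A' ← append #[] i
      AVL.insertAt map k (t, A')

/-- The inverted index of the positions `1, …, n` of the tokens, as a list of entries `(t, A)`. -/
def buildMap (T : List α) : Run (List (α × Array ℕ)) := do
  let (map, _) ← forList T ((AVL.nil : PosMap α), 1) fun t (map, i) => do
    let map' ← addPosition map t i
    let i' ← addN i 1
    return (map', i')
  AVL.toList map []

/-- `GenerateKeys`. -/
def generateKeys (T : List α) (h : α → ℕ → ℕ) : Run (List HKey) := do
  let entries ← buildMap T
  forList entries [] fun (t, A) K =>
    forRange 0 A.size K fun i K => do
      let cnt ← subN A.size i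
      forRange i cnt K fun j K => do
        let p ← read A i
        let q ← read A j
        let m ← subN j i
        let x ← addN m 1
        let v ← hash h t x
        cons ⟨p, q, v⟩ K

/-- `GenerateActiveKeys`. -/
def generateActiveKeys (T : List α) (h : α → ℕ → ℕ) : Run (List HKey) := do
  let entries ← buildMap T
  forList entries [] fun (t, A) K => do
    let (K, _) ← forRange 1 A.size (K, (⊤ : WithTop ℕ)) fun x (K, minkey) => do
      let v ← hash h t x
      if ← lt (v : WithTop ℕ) minkey then
        let m ← addN A.size 1
        let cnt ← subN m x
        let K' ← forRange 0 cnt K fun i K => do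
          let u ← addN i x
          let e ← subN u 1
          let p ← read A i
          let q ← read A e
          cons ⟨p, q, v⟩ K
        return (K', (v : WithTop ℕ))
      else
        return (K, minkey)
    return K

/-- The keys in ascending order of the hash value, sorted by insertion into a balanced tree. -/
def sortKeys (K : List HKey) : Run (List HKey) := do
  let t ← forList K (AVL.nil : AVL HKey) fun s t => do
    let k ← AVL.search (fun s' => le s'.v s.v) t 0
    AVL.insertAt t k s
  AVL.toList t []

/-- `(p, q)` dominates `(p', q')`, i.e. `[p, q] ⊂ [p', q']`. -/
def dominates (s s' : ℕ × ℕ) : Run Bool := do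
  if ← le s'.1 s.1 then
    if ← le s.2 s'.2 then
      if ← eq s.1 s'.1 then
        if ← eq s.2 s'.2 then
          return false
        else
          return true
      else
        return true
    else
      return false
  else
    return false

/-- One round of the main loop: visit the key `(b, c)` of hash value `v`, with the skyline `S` in
coordinate order and the windows `P` generated so far. -/
def visit (key : HKey) (S : AVL (ℕ × ℕ)) (P : List Window) :
    Run (AVL (ℕ × ℕ) × List Window) := do
  let b := key.p
  let c := key.q
  let cnt' ← AVL.search (fun s => le s.2 c) S 0
  let j' ← subN cnt' 1
  let sj ← AVL.get? S j'
  if ← dominates (sj.getD (0, 0)) (b, c) then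
    return (S, P)
  else
    let cnt ← AVL.search (fun s => lt s.2 c) S 0
    let i ← subN cnt 1
    let j ← AVL.search (fun s => le s.1 b) S 0
    let len ← subN j i
    let (P', _) ← forRange i len (P, c) fun k (P, c') => do
      let sk ← AVL.get? S k
      let k' ← addN k 1
      let sk' ← AVL.get? S k'
      let a ← addN (sk.getD (0, 0)).1 1
      let d ← subN (sk'.getD (0, 0)).2 1
      if ← le a b then
        if ← le c' d then
          let P' ← cons ⟨key.v, a, b, c', d⟩ P
          return (P', (sk'.getD (0, 0)).2)
        else
          return (P, (sk'.getD (0, 0)).2)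
      else
        return (P, (sk'.getD (0, 0)).2)
    let i' ← addN i 1
    let rem ← subN j i'
    let S' ← forRange i' rem S fun _ S => AVL.removeAt S i'
    let S'' ← AVL.insertAt S' i' (b, c)
    return (S'', P')

/-- `MonotonicPartitioning`, with the procedure that generates the keys as a parameter.  The text
itself occupies `n` cells. -/
def monotonicPartitioning (gen : List α → (α → ℕ → ℕ) → Run (List HKey))
    (T : List α) (h : α → ℕ → ℕ) : Run (List Window) := do
  alloc T.length
  let K ← gen T h
  let n1 ← addN T.length 1
  let S₀ ← AVL.insertAt AVL.nil 0 ((0, 0) : ℕ × ℕ)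
  let S₁ ← AVL.insertAt S₀ 1 (n1, n1)
  let order ← sortKeys K
  let (_, P) ← forList order (S₁, ([] : List Window)) fun key (S, P) => visit key S P
  return P

/-- `MonotonicPartitioning` with `GenerateActiveKeys`. -/
def monoActive (T : List α) (h : α → ℕ → ℕ) : Run (List Window) :=
  monotonicPartitioning generateActiveKeys T h

/-- `MonotonicPartitioning` with `GenerateKeys`. -/
def monoAll (T : List α) (h : α → ℕ → ℕ) : Run (List Window) :=
  monotonicPartitioning generateKeys T h

/-! ### Active keys, maximum frequency, random hash functions -/

/-- `T[p, q]`, with positions counted from 1. -/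
def slice (T : List α) (p q : ℕ) : List α := (T.take q).drop (p - 1)

/-- `(p, q)` is a key of `T`. -/
def IsKey (T : List α) (p q : ℕ) : Prop :=
  1 ≤ p ∧ p ≤ q ∧ q ≤ T.length ∧ T[p - 1]? = T[q - 1]?

/-- The hash value `h(t, x)` is active. -/
def IsActiveHash (h : α → ℕ → ℕ) (t : α) (x : ℕ) : Prop :=
  ∀ x', 1 ≤ x' → x' < x → h t x < h t x'

/-- `(p, q)` is an active key of `T`. -/
def IsActiveKey (T : List α) (h : α → ℕ → ℕ) (p q : ℕ) : Prop :=
  IsKey T p q ∧ ∃ t, T[q - 1]? = some t ∧ IsActiveHash h t ((slice T p q).count t)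

open Classical in
/-- The set `X(T)` of active keys. -/
noncomputable def activeKeys (T : List α) (h : α → ℕ → ℕ) : Finset (ℕ × ℕ) :=
  (Finset.Icc 1 T.length ×ˢ Finset.Icc 1 T.length).filter fun s => IsActiveKey T h s.1 s.2

/-- The maximum token frequency `f_T`. -/
def maxFreq (T : List α) : ℕ := T.toFinset.sup fun t => T.count t

/-- The arguments `(t, x)` whose hash values occur in `T`: `t ∈ T` and `1 ≤ x ≤ f(t, T)`. -/
def hashArgs (T : List α) : Set (α × ℕ) := {e | e.1 ∈ T ∧ 1 ≤ e.2 ∧ e.2 ≤ T.count e.1}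

/-- `H` is an (ideal) random hash function on the arguments occurring in `T`: no two hash values
collide, and the joint law of the hash values is invariant under permuting the arguments.  For
instance, `H` may be a uniformly random injection of the arguments into `{0, …, M - 1}`. -/
structure IsRandomHash {Ω : Type*} [MeasurableSpace Ω] (μ : Measure Ω) (T : List α)
    (H : Ω → α → ℕ → ℕ) : Prop where
  noCollision : ∀ᵐ ω ∂μ, Set.InjOn (fun e : α × ℕ => H ω e.1 e.2) (hashArgs T)
  exchangeable : ∀ σ : Equiv.Perm (hashArgs T),
    IdentDistrib (fun ω (e : hashArgs T) => H ω e.1.1 e.1.2)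
      (fun ω (e : hashArgs T) => H ω (σ e).1.1 (σ e).1.2) μ μ

end TextAlign

/-! Everything reduces to the number N of generated keys. In a height-balanced tree every operation
costs O(log) time and uses at most one stack frame per level, so building the index takes O(n log n)
steps, listing the keys O(n + N), and sorting them O(N log N). The main loop is amortized with the
size of the skyline as potential (`visit_spec`): a round outputs at most one window more than the
number of elements it removes, and every element was inserted by an earlier round or at the start.
Hence time O(N log N) and space O(N) whenever n ≤ N (`monotonicPartitioning_bounds`). Only the
balance and size of the skyline matter here, not the geometry of its points.

It remains to count. Active keys correspond bijectively to triples of a token t, an active x and the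
rank of the first of the x occurrences (`card_activeKeys`), which is what the generator lists at
most. From n ≤ |X(T)| ≤ n² the logarithm of N is O(log n). All keys number at most Σ f(t,T)² ≤ n
f_T.

For a random hash, exchangeability makes each of h(t,1), …, h(t,x) equally likely to be the strict
minimum, and these events are disjoint; so h(t,x) is active with probability at most 1/x
(`IsRandomHash.measure_active_le`). With m = f(t,T), token t contributes at most Σ (m+1-x)/x ≤ m(1 +
log m) in expectation, and the sum over t is at most n(1 + log f_T). The expected costs follow by
integrating the pointwise bounds in terms of |X(T)|. -/

namespace TextAlign

/-! ### Projections of runs -/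

namespace Run

variable {β γ : Type}

@[simp] theorem pure_val (a : β) : (pure a : Run β).val = a := rfl
@[simp] theorem pure_time (a : β) : (pure a : Run β).time = 0 := rfl
@[simp] theorem pure_net (a : β) : (pure a : Run β).net = 0 := rfl
@[simp] theorem pure_peak (a : β) : (pure a : Run β).peak = 0 := rfl

@[simp] theorem bind_val (m : Run β) (f : β → Run γ) : (m >>= f).val = (f m.val).val := rfl
@[simp] theorem bind_time (m : Run β) (f : β → Run γ) :
    (m >>= f).time = m.time + (f m.val).time := rfl
@[simp] theorem bind_net (m : Run β) (f : β → Run γ) :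
    (m >>= f).net = m.net + (f m.val).net := rfl
@[simp] theorem bind_peak (m : Run β) (f : β → Run γ) :
    (m >>= f).peak = max m.peak (m.net + ((f m.val).peak : ℤ)).toNat := rfl

end Run

section primitives

variable {β : Type}

@[simp] theorem step_val (a : β) : (step a).val = a := rfl
@[simp] theorem step_time (a : β) : (step a).time = 1 := rfl
@[simp] theorem step_net (a : β) : (step a).net = 0 := rfl
@[simp] theorem step_peak (a : β) : (step a).peak = 0 := rfl

@[simp] theorem alloc_time (k : ℕ) : (alloc k).time = k := rfl
@[simp] theorem alloc_net (k : ℕ) : (alloc k).net = k := rfl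
@[simp] theorem alloc_peak (k : ℕ) : (alloc k).peak = k := rfl

@[simp] theorem free_time : free.time = 1 := rfl
@[simp] theorem free_net : free.net = -1 := rfl
@[simp] theorem free_peak : free.peak = 0 := rfl

@[simp] theorem call_val (m : Run β) : (call m).val = m.val := rfl
@[simp] theorem call_time (m : Run β) : (call m).time = m.time + 2 := by
  simp [call]; omega
@[simp] theorem call_net (m : Run β) : (call m).net = m.net := by
  simp [call]
-- An arbitrary record need not satisfy `net ≤ peak`, and the frame is still occupied when `m` ends;
-- hence both bounds are required.
theorem call_peak_le (m : Run β) {b : ℕ} (hp : m.peak ≤ b) (hn : m.net ≤ b) :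
    (call m).peak ≤ b + 1 := by
  simp [call]; omega

@[simp] theorem cons_val (a : β) (l : List β) : (cons a l).val = a :: l := rfl
@[simp] theorem cons_time (a : β) (l : List β) : (cons a l).time = 2 := rfl
@[simp] theorem cons_net (a : β) (l : List β) : (cons a l).net = 1 := rfl
@[simp] theorem cons_peak (a : β) (l : List β) : (cons a l).peak = 1 := rfl

@[simp] theorem append_val (A : Array ℕ) (a : ℕ) : (append A a).val = A.push a := rfl
@[simp] theorem append_time (A : Array ℕ) (a : ℕ) : (append A a).time = 2 := rfl
@[simp] theorem append_net (A : Array ℕ) (a : ℕ) : (append A a).net = 1 := rfl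
@[simp] theorem append_peak (A : Array ℕ) (a : ℕ) : (append A a).peak = 1 := rfl

end primitives

attribute [simp] tick addN subN maxN hash read

section branching

variable {β γ : Type} [LinearOrder β]

-- Replacing a Boolean test by a tick and a propositional `if` lets case splits on the comparison
-- evaluate both the result and the cost of a program.
@[simp] theorem le_bind (a b : β) (x y : Run γ) :
    (le a b >>= fun c => if c = true then x else y) = (tick >>= fun _ => if a ≤ b then x else y) := by
  by_cases h : a ≤ b <;> simp only [le, h, decide_true, decide_false] <;> rfl

@[simp] theorem lt_bind (a b : β) (x y : Run γ) :
    (lt a b >>= fun c => if c = true then x else y) = (tick >>= fun _ => if a < b then x else y) := by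
  by_cases h : a < b <;> simp only [lt, h, decide_true, decide_false] <;> rfl

@[simp] theorem eq_bind (a b : β) (x y : Run γ) :
    (eq a b >>= fun c => if c = true then x else y) = (tick >>= fun _ => if a = b then x else y) := by
  by_cases h : a = b <;> simp only [eq, h, decide_true, decide_false] <;> rfl

end branching

/-! ### Loops

The invariants refer to the time spent and the cells occupied since the loop started. -/

section loops

variable {β σ : Type}

/-- The invariant sees accumulated time and cells, so amortized arguments become ordinary
invariants. Arbitrary starting values `t`, `u` make the induction on the number of rounds go
through; the tick of the exit test is kept outside the invariant. -/
theorem forRange_induction_from (f : ℕ → σ → Run σ) (I : ℕ → σ → ℕ → ℤ → Prop) (B hi : ℕ)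
    (hend : ∀ s t u, I hi s t u → u ≤ B)
    (hstep : ∀ i s t u, i < hi → I i s t u →
      I (i + 1) (f i s).val (t + 1 + (f i s).time) (u + (f i s).net) ∧
        u + (f i s).peak ≤ B)
    (cnt lo : ℕ) (hlo : lo + cnt = hi) (s : σ) (t : ℕ) (u : ℤ) (h0 : I lo s t u) :
    ∃ t', (forRange lo cnt s f).time = t' + 1 ∧
      I hi (forRange lo cnt s f).val (t + t') (u + (forRange lo cnt s f).net) ∧
      u + (forRange lo cnt s f).peak ≤ B := by
  induction cnt generalizing lo s t u with
  | zero =>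
    obtain rfl : lo = hi := by omega
    refine ⟨0, rfl, ?_, ?_⟩
    · simpa [forRange] using h0
    · simpa [forRange] using hend _ _ _ h0
  | succ k ih =>
    obtain ⟨h1, h2⟩ := hstep lo s t u (by omega) h0
    obtain ⟨t', ht, hI, hp⟩ := ih (lo + 1) (by omega) _ _ _ h1
    refine ⟨1 + (f lo s).time + t', ?_, ?_, ?_⟩
    · simp [forRange, ht]; omega
    · simp only [forRange, tick, Run.bind_val, Run.bind_net, step_net]
      convert hI using 1 <;> omega
    · simp only [forRange, tick, Run.bind_peak, step_net, step_peak]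
      omega

/-- Rule for `forRange`. -/
theorem forRange_induction {f : ℕ → σ → Run σ} (I : ℕ → σ → ℕ → ℤ → Prop) (B : ℕ)
    {lo cnt : ℕ} {s : σ} (h0 : I lo s 0 0)
    (hend : ∀ s t u, I (lo + cnt) s t u → u ≤ B)
    (hstep : ∀ i s t u, i < lo + cnt → I i s t u →
      I (i + 1) (f i s).val (t + 1 + (f i s).time) (u + (f i s).net) ∧
        u + (f i s).peak ≤ B) :
    ∃ t, (forRange lo cnt s f).time = t + 1 ∧
      I (lo + cnt) (forRange lo cnt s f).val t (forRange lo cnt s f).net ∧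
      (forRange lo cnt s f).peak ≤ B := by
  obtain ⟨t, ht, hI, hp⟩ := forRange_induction_from f I B (lo + cnt) hend hstep cnt lo rfl s 0 0 h0
  exact ⟨t, ht, by simpa using hI, by omega⟩

theorem forList_induction_from (f : β → σ → Run σ) (I : List β → σ → ℕ → ℤ → Prop) (B : ℕ)
    (hend : ∀ s t u, I [] s t u → u ≤ B)
    (hstep : ∀ a l s t u, I (a :: l) s t u →
      I l (f a s).val (t + 1 + (f a s).time) (u + (f a s).net) ∧ u + (f a s).peak ≤ B)
    (l : List β) (s : σ) (t : ℕ) (u : ℤ) (h0 : I l s t u) :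
    ∃ t', (forList l s f).time = t' + 1 ∧
      I [] (forList l s f).val (t + t') (u + (forList l s f).net) ∧
      u + (forList l s f).peak ≤ B := by
  induction l generalizing s t u with
  | nil =>
    refine ⟨0, rfl, ?_, ?_⟩
    · simpa [forList] using h0
    · simpa [forList] using hend _ _ _ h0
  | cons a l ih =>
    obtain ⟨h1, h2⟩ := hstep a l s t u h0
    obtain ⟨t', ht, hI, hp⟩ := ih _ _ _ h1
    refine ⟨1 + (f a s).time + t', ?_, ?_, ?_⟩
    · simp [forList, ht]; omega
    · simp only [forList, tick, Run.bind_val, Run.bind_net, step_net]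
      convert hI using 1 <;> omega
    · simp only [forList, tick, Run.bind_peak, step_net, step_peak]
      omega

/-- Rule for `forList`; the first argument of the invariant is the list of pending elements. -/
theorem forList_induction {f : β → σ → Run σ} (I : List β → σ → ℕ → ℤ → Prop) (B : ℕ)
    {l : List β} {s : σ} (h0 : I l s 0 0)
    (hend : ∀ s t u, I [] s t u → u ≤ B)
    (hstep : ∀ a l s t u, I (a :: l) s t u →
      I l (f a s).val (t + 1 + (f a s).time) (u + (f a s).net) ∧ u + (f a s).peak ≤ B) :
    ∃ t, (forList l s f).time = t + 1 ∧
      I [] (forList l s f).val t (forList l s f).net ∧ (forList l s f).peak ≤ B := by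
  obtain ⟨t, ht, hI, hp⟩ := forList_induction_from f I B hend hstep l s 0 0 h0
  exact ⟨t, ht, by simpa using hI, by omega⟩

end loops

/-! ### Correctness and cost of the search tree -/

namespace AVL

variable {β : Type}

/-- The in-order sequence. -/
def inorder : AVL β → List β
  | nil => []
  | node l a r _ _ => inorder l ++ a :: inorder r

/-- The tree is height-balanced, and the stored heights and sizes are correct. -/
def WF : AVL β → Prop
  | nil => True
  | node l _ r k s => WF l ∧ WF r ∧ k = max l.ht r.ht + 1 ∧ s = l.sz + r.sz + 1 ∧
      l.ht ≤ r.ht + 1 ∧ r.ht ≤ l.ht + 1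

@[simp] theorem inorder_nil : (nil : AVL β).inorder = [] := rfl
@[simp] theorem inorder_node (l : AVL β) (a : β) (r : AVL β) (k s : ℕ) :
    (node l a r k s).inorder = l.inorder ++ a :: r.inorder := rfl
@[simp] theorem wf_nil : (nil : AVL β).WF := trivial
@[simp] theorem ht_nil : (nil : AVL β).ht = 0 := rfl
@[simp] theorem sz_nil : (nil : AVL β).sz = 0 := rfl
@[simp] theorem ht_node (l : AVL β) (a : β) (r : AVL β) (k s : ℕ) :
    (node l a r k s).ht = k := rfl
@[simp] theorem sz_node (l : AVL β) (a : β) (r : AVL β) (k s : ℕ) :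
    (node l a r k s).sz = s := rfl

theorem WF.length_inorder {t : AVL β} (h : t.WF) : t.inorder.length = t.sz := by
  induction t with
  | nil => rfl
  | node l a r k s ihl ihr =>
    obtain ⟨hl, hr, -, rfl, -, -⟩ := h
    simp [ihl hl, ihr hr]; omega

theorem WF.ht_le_sz {t : AVL β} (h : t.WF) : t.ht ≤ t.sz := by
  induction t with
  | nil => simp
  | node l a r k s ihl ihr =>
    obtain ⟨hl, hr, rfl, rfl, -, -⟩ := h
    have := ihl hl
    have := ihr hr
    simp; omega

/-- Both children of a node of height k have height at least k - 2, so size plus one at least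
doubles with every two levels. This crude form of the Fibonacci bound suffices. -/
theorem WF.two_pow_le {t : AVL β} (h : t.WF) : 2 ^ (t.ht / 2) ≤ t.sz + 1 := by
  induction t with
  | nil => simp
  | node l a r k s ihl ihr =>
    obtain ⟨hl, hr, rfl, rfl, h1, h2⟩ := h
    have i1 := ihl hl
    have i2 := ihr hr
    simp only [ht_node, sz_node]
    rcases Nat.eq_zero_or_pos ((max l.ht r.ht + 1) / 2) with h0 | h0
    · rw [h0]; omega
    · obtain ⟨m, hm⟩ := Nat.exists_eq_succ_of_ne_zero h0.ne'
      rw [hm, pow_succ]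
      have e1 : 2 ^ m ≤ 2 ^ (l.ht / 2) := Nat.pow_le_pow_right (by norm_num) (by omega)
      have e2 : 2 ^ m ≤ 2 ^ (r.ht / 2) := Nat.pow_le_pow_right (by norm_num) (by omega)
      omega

theorem WF.ht_le_log {t : AVL β} (h : t.WF) {M : ℕ} (hM : t.sz + 1 ≤ M) :
    t.ht ≤ 2 * Nat.log 2 M + 1 := by
  have := Nat.le_log_of_pow_le (by norm_num) (h.two_pow_le.trans hM)
  omega

section mk

@[simp] theorem mk_val (l : AVL β) (a : β) (r : AVL β) :
    (mk l a r).val = node l a r (max l.ht r.ht + 1) (l.sz + r.sz + 1) := rfl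
@[simp] theorem mk_time (l : AVL β) (a : β) (r : AVL β) : (mk l a r).time = 5 := rfl
@[simp] theorem mk_net (l : AVL β) (a : β) (r : AVL β) : (mk l a r).net = 0 := rfl
@[simp] theorem mk_peak (l : AVL β) (a : β) (r : AVL β) : (mk l a r).peak = 0 := rfl

end mk

theorem bal_cost (l : AVL β) (a : β) (r : AVL β) :
    (bal l a r).time ≤ 25 ∧ (bal l a r).net = 0 ∧ (bal l a r).peak = 0 := by
  unfold bal
  simp only [lt_bind, le_bind]
  by_cases c1 : r.ht + 1 < l.ht
  · rcases l with _ | ⟨ll, la, lr, _, _⟩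
    · simp at c1
    · rw [ht_node] at c1
      by_cases c3 : lr.ht ≤ ll.ht
      · simp [c3, c1]
      · rcases lr with _ | ⟨lrl, lra, lrr, _, _⟩
        · simp at c3
        · rw [ht_node] at c3
          simp [c1, c3]
  by_cases c2 : l.ht + 1 < r.ht
  · rcases r with _ | ⟨rl, ra, rr, _, _⟩
    · simp at c2
    · rw [ht_node] at c1 c2
      by_cases c3 : rl.ht ≤ rr.ht
      · simp [c3, c1, c2]
      · rcases rl with _ | ⟨rll, rla, rlr, _, _⟩
        · simp at c3
        · rw [ht_node] at c3
          simp [c1, c2, c3]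
  · simp [c1, c2]

@[simp] theorem bal_net (l : AVL β) (a : β) (r : AVL β) : (bal l a r).net = 0 :=
  (bal_cost l a r).2.1
@[simp] theorem bal_peak (l : AVL β) (a : β) (r : AVL β) : (bal l a r).peak = 0 :=
  (bal_cost l a r).2.2

/-- A height difference of 2 is the worst that one update below can cause. The last clause records
that the height is exact when no rotation is needed; without it, updates could not be shown to
change heights by at most one. -/
theorem bal_spec {l : AVL β} {a : β} {r : AVL β} (hl : l.WF) (hr : r.WF)
    (h1 : l.ht ≤ r.ht + 2) (h2 : r.ht ≤ l.ht + 2) :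
    (bal l a r).val.WF ∧ (bal l a r).val.inorder = l.inorder ++ a :: r.inorder ∧
      max l.ht r.ht ≤ (bal l a r).val.ht ∧ (bal l a r).val.ht ≤ max l.ht r.ht + 1 ∧
      (l.ht ≤ r.ht + 1 → r.ht ≤ l.ht + 1 → (bal l a r).val.ht = max l.ht r.ht + 1) := by
  unfold bal
  simp only [lt_bind, le_bind]
  by_cases c1 : r.ht + 1 < l.ht
  · rcases l with _ | ⟨ll, la, lr, k, s⟩
    · simp at c1
    obtain ⟨w1, w2, hk, hs, w3, w4⟩ := hl
    simp only [ht_node] at c1 h1 h2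
    by_cases c3 : lr.ht ≤ ll.ht
    · simp [WF, w1, w2, hr, c1, c3]; omega
    rcases lr with _ | ⟨lrl, lra, lrr, k', s'⟩
    · simp at c3
    obtain ⟨v1, v2, hk', hs', v3, v4⟩ := w2
    simp only [ht_node] at c3 w3 w4 hk
    simp [WF, w1, v1, v2, hr, c1, c3]; omega
  by_cases c2 : l.ht + 1 < r.ht
  · rcases r with _ | ⟨rl, ra, rr, k, s⟩
    · simp at c2
    obtain ⟨w1, w2, hk, hs, w3, w4⟩ := hr
    simp only [ht_node] at c1 c2 h1 h2
    by_cases c3 : rl.ht ≤ rr.ht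
    · simp [WF, w1, w2, hl, c1, c2, c3]; omega
    rcases rl with _ | ⟨rll, rla, rlr, k', s'⟩
    · simp at c3
    obtain ⟨v1, v2, hk', hs', v3, v4⟩ := w1
    simp only [ht_node] at c3 w3 w4 hk
    simp [WF, w2, v1, v2, hl, c1, c2, c3]; omega
  · simp [WF, hl, hr, c1, c2]; omega

theorem insertAt_spec {t : AVL β} (h : t.WF) (i : ℕ) (x : β) :
    (insertAt t i x).val.WF ∧
      (insertAt t i x).val.inorder = t.inorder.take i ++ x :: t.inorder.drop i ∧
      t.ht ≤ (insertAt t i x).val.ht ∧ (insertAt t i x).val.ht ≤ t.ht + 1 := by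
  induction t generalizing i with
  | nil => simp [insertAt, WF]
  | node l a r k s ihl ihr =>
    obtain ⟨hl, hr, rfl, rfl, h1, h2⟩ := h
    by_cases c : i ≤ l.sz
    · have E : (insertAt (node l a r (max l.ht r.ht + 1) (l.sz + r.sz + 1)) i x).val =
          (bal (insertAt l i x).val a r).val := by simp [insertAt, c]
      rw [E]
      obtain ⟨w, e, b1, b2⟩ := ihl hl i
      obtain ⟨w', e', b3, b4, b5⟩ := bal_spec (a := a) w hr (by omega) (by omega)
      refine ⟨w', ?_, ?_, ?_⟩
      · rw [← hl.length_inorder] at c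
        simp [e', e, List.take_append_of_le_length c, List.drop_append_of_le_length c]
      all_goals simp; omega
    · have E : (insertAt (node l a r (max l.ht r.ht + 1) (l.sz + r.sz + 1)) i x).val =
          (bal l a (insertAt r (i - l.sz - 1) x).val).val := by simp [insertAt, c]
      rw [E]
      obtain ⟨w, e, b1, b2⟩ := ihr hr (i - l.sz - 1)
      obtain ⟨w', e', b3, b4, b5⟩ := bal_spec (a := a) hl w (by omega) (by omega)
      refine ⟨w', ?_, ?_, ?_⟩
      · have hlen := hl.length_inorder
        obtain ⟨m, rfl⟩ : ∃ m, i = l.inorder.length + (m + 1) :=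
          ⟨i - l.sz - 1, by omega⟩
        have : l.inorder.length + (m + 1) - l.sz - 1 = m := by omega
        rw [this] at e
        rw [this] at e' ⊢
        simp [e', e, List.take_length_add_append, List.drop_length_add_append]
      all_goals simp; omega

/-- A level costs at most 25 steps of rebalancing plus a few for the call and the index arithmetic.
The peak is one frame per level plus the new node. -/
theorem insertAt_cost {t : AVL β} (h : t.WF) (i : ℕ) (x : β) :
    (insertAt t i x).time ≤ 31 * (t.ht + 1) ∧ (insertAt t i x).net = 1 ∧
      (insertAt t i x).peak ≤ t.ht + 1 := by
  induction t generalizing i with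
  | nil => simp [insertAt]
  | node l a r k s ihl ihr =>
    obtain ⟨hl, hr, rfl, rfl, h1, h2⟩ := h
    simp only [insertAt, call_time, call_net, ht_node]
    obtain ⟨p1, p2, p3⟩ := ihl hl i
    obtain ⟨q1, q2, q3⟩ := ihr hr (i - l.sz - 1)
    have k1 := (bal_cost (insertAt l i x).val a r).1
    have k2 := (bal_cost l a (insertAt r (i - l.sz - 1) x).val).1
    by_cases c : i ≤ l.sz
    · refine ⟨?_, ?_, call_peak_le _ ?_ ?_⟩ <;> simp [c] <;> omega
    · refine ⟨?_, ?_, call_peak_le _ ?_ ?_⟩ <;> simp [c] <;> omega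

theorem insertAt_sz {t : AVL β} (h : t.WF) (i : ℕ) (x : β) :
    (insertAt t i x).val.sz = t.sz + 1 := by
  obtain ⟨w, e, -⟩ := insertAt_spec h i x
  rw [← w.length_inorder, e, ← h.length_inorder]
  simp; omega

/-- Under removal only shape and size are followed: the cost of the main loop does not depend on
which elements survive. -/
theorem popMin_spec {l : AVL β} {a : β} {r : AVL β} {k s : ℕ} (h : (node l a r k s).WF) :
    (popMin l a r).val.2.WF ∧ (popMin l a r).val.2.sz + 1 = s ∧
      (popMin l a r).val.2.ht ≤ k ∧ k ≤ (popMin l a r).val.2.ht + 1 := by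
  induction l generalizing a r k s with
  | nil =>
    obtain ⟨-, hr, rfl, rfl, h1, h2⟩ := h
    simp [popMin, hr]
  | node ll la lr kl sl ihl ihr =>
    obtain ⟨hl, hr, rfl, rfl, h1, h2⟩ := h
    obtain ⟨w, e, b1, b2⟩ := ihl hl
    simp only [popMin, call_val, Run.bind_val, Run.pure_val]
    simp only [ht_node] at h1 h2 ⊢
    obtain ⟨w', e', b3, b4, b5⟩ := bal_spec (a := a) w hr (by omega) (by omega)
    refine ⟨w', ?_, by omega, by omega⟩
    rw [← w'.length_inorder, e', List.length_append, List.length_cons, w.length_inorder,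
      hr.length_inorder, sz_node]
    omega

theorem popMin_cost {l : AVL β} {a : β} {r : AVL β} {k s : ℕ} (h : (node l a r k s).WF) :
    (popMin l a r).time ≤ 31 * k ∧ (popMin l a r).net = -1 ∧ (popMin l a r).peak ≤ k := by
  induction l generalizing a r k s with
  | nil =>
    obtain ⟨-, hr, rfl, rfl, h1, h2⟩ := h
    simp [popMin]; omega
  | node ll la lr kl sl ihl ihr =>
    obtain ⟨hl, hr, rfl, rfl, h1, h2⟩ := h
    obtain ⟨p1, p2, p3⟩ := ihl hl
    have k1 := (bal_cost (popMin ll la lr).val.2 a r).1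
    simp only [popMin, call_time, call_net, ht_node]
    refine ⟨?_, ?_, call_peak_le _ ?_ ?_⟩ <;> simp <;> omega

theorem removeAt_spec {t : AVL β} (h : t.WF) (i : ℕ) :
    (removeAt t i).val.WF ∧ (i < t.sz → (removeAt t i).val.sz + 1 = t.sz) ∧
      (t.sz ≤ i → (removeAt t i).val.sz = t.sz) ∧
      (removeAt t i).val.ht ≤ t.ht ∧ t.ht ≤ (removeAt t i).val.ht + 1 := by
  induction t generalizing i with
  | nil => simp [removeAt]
  | node l a r k s ihl ihr =>
    obtain ⟨hl, hr, rfl, rfl, h1, h2⟩ := h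
    simp only [ht_node, sz_node]
    by_cases c1 : i < l.sz
    · have E : (removeAt (node l a r (max l.ht r.ht + 1) (l.sz + r.sz + 1)) i).val =
          (bal (removeAt l i).val a r).val := by simp [removeAt, c1]
      rw [E]
      obtain ⟨w, e, f, b1, b2⟩ := ihl hl i
      obtain ⟨w', e', b3, b4, b5⟩ := bal_spec (a := a) w hr (by omega) (by omega)
      have hsz := w'.length_inorder
      rw [e', List.length_append, List.length_cons, w.length_inorder,
        hr.length_inorder] at hsz
      refine ⟨w', ?_, ?_, ?_, ?_⟩ <;> omega
    by_cases c2 : l.sz < i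
    · have E : (removeAt (node l a r (max l.ht r.ht + 1) (l.sz + r.sz + 1)) i).val =
          (bal l a (removeAt r (i - l.sz - 1)).val).val := by simp [removeAt, c1, c2]
      rw [E]
      obtain ⟨w, e, f, b1, b2⟩ := ihr hr (i - l.sz - 1)
      obtain ⟨w', e', b3, b4, b5⟩ := bal_spec (a := a) hl w (by omega) (by omega)
      have hsz := w'.length_inorder
      rw [e', List.length_append, List.length_cons, w.length_inorder,
        hl.length_inorder] at hsz
      refine ⟨w', ?_, ?_, ?_, ?_⟩ <;> omega
    -- Here `i = l.sz`: the root itself is removed, and replaced by the minimum of the right subtree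
    -- if there is one.
    · rcases r with _ | ⟨rl, ra, rr, kr, sr⟩
      · simp only [ht_nil] at h1
        simp [removeAt, c1, c2, hl]
      · have E : (removeAt (node l a (node rl ra rr kr sr) (max l.ht kr + 1)
            (l.sz + sr + 1)) i).val =
            (bal l (popMin rl ra rr).val.1 (popMin rl ra rr).val.2).val := by
          simp [removeAt, c1, c2]
        obtain ⟨w, e, b1, b2⟩ := popMin_spec hr
        simp only [ht_node, sz_node] at h1 h2 ⊢
        obtain ⟨w', e', b3, b4, b5⟩ :=
          bal_spec (a := (popMin rl ra rr).val.1) hl w (by omega) (by omega)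
        rw [E]
        have hsz := w'.length_inorder
        rw [e', List.length_append, List.length_cons, w.length_inorder,
          hl.length_inorder] at hsz
        refine ⟨w', ?_, ?_, ?_, ?_⟩ <;> omega

theorem removeAt_cost {t : AVL β} (h : t.WF) (i : ℕ) :
    (removeAt t i).time ≤ 35 * (t.ht + 1) ∧
      (i < t.sz → (removeAt t i).net = -1) ∧
      (t.sz ≤ i → (removeAt t i).net = 0) ∧ (removeAt t i).peak ≤ t.ht + 1 := by
  induction t generalizing i with
  | nil => simp [removeAt]
  | node l a r k s ihl ihr =>
    obtain ⟨hl, hr, rfl, rfl, h1, h2⟩ := h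
    simp only [removeAt, call_time, call_net, ht_node, sz_node]
    obtain ⟨p1, p2, p2', p3⟩ := ihl hl i
    obtain ⟨q1, q2, q2', q3⟩ := ihr hr (i - l.sz - 1)
    have k1 := (bal_cost (removeAt l i).val a r).1
    have k2 := (bal_cost l a (removeAt r (i - l.sz - 1)).val).1
    by_cases c1 : i < l.sz
    · refine ⟨?_, ?_, ?_, call_peak_le _ ?_ ?_⟩ <;> simp [c1] <;> omega
    by_cases c2 : l.sz < i
    · refine ⟨?_, ?_, ?_, call_peak_le _ ?_ ?_⟩ <;> simp [c1, c2] <;> omega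
    · rcases r with _ | ⟨rl, ra, rr, kr, sr⟩
      · refine ⟨?_, ?_, ?_, call_peak_le _ ?_ ?_⟩ <;> simp [c1, c2] <;> omega
      · obtain ⟨m1, m2, m3⟩ := popMin_cost hr
        have k3 := (bal_cost l (popMin rl ra rr).val.1 (popMin rl ra rr).val.2).1
        refine ⟨?_, ?_, ?_, call_peak_le _ ?_ ?_⟩ <;> simp [c1, c2] <;> omega

theorem get?_spec {t : AVL β} (h : t.WF) (i : ℕ) :
    (get? t i).val = t.inorder[i]? ∧ (get? t i).time ≤ 5 * (t.ht + 1) ∧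
      (get? t i).net = 0 ∧ (get? t i).peak = 0 := by
  induction t generalizing i with
  | nil => simp [get?]
  | node l a r k s ihl ihr =>
    obtain ⟨hl, hr, rfl, rfl, h1, h2⟩ := h
    obtain ⟨p1, p2, p3, p4⟩ := ihl hl i
    obtain ⟨q1, q2, q3, q4⟩ := ihr hr (i - l.sz - 1)
    have hlen := hl.length_inorder
    by_cases c1 : i < l.sz
    · refine ⟨?_, ?_, ?_, ?_⟩
      · simp [get?, c1, p1, List.getElem?_append_left (hlen ▸ c1)]
      all_goals simp [get?, c1, p3, p4]
      omega
    by_cases c2 : l.sz < i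
    · refine ⟨?_, ?_, ?_, ?_⟩
      · obtain ⟨m, rfl⟩ : ∃ m, i = l.inorder.length + (m + 1) := ⟨i - l.sz - 1, by omega⟩
        have : l.inorder.length + (m + 1) - l.sz - 1 = m := by omega
        rw [this] at q1
        simp only [get?, tick, lt_bind, subN, Run.bind_val, step_val, if_neg c1,
          if_pos c2, this, q1, inorder_node]
        rw [List.getElem?_append_right (by omega)]
        simp
      all_goals simp [get?, c1, c2, q3, q4]
      omega
    · obtain rfl : i = l.sz := by omega
      refine ⟨?_, ?_, ?_, ?_⟩
      · simp [get?, ← hlen]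
      all_goals simp [get?]
      omega

theorem setAt_spec {t : AVL β} (h : t.WF) (i : ℕ) (x : β) :
    (setAt t i x).val.WF ∧ (setAt t i x).val.ht = t.ht ∧ (setAt t i x).val.sz = t.sz ∧
      (setAt t i x).val.inorder = t.inorder.set i x := by
  induction t generalizing i with
  | nil => simp [setAt]
  | node l a r k s ihl ihr =>
    obtain ⟨hl, hr, rfl, rfl, h1, h2⟩ := h
    obtain ⟨p1, p2, p3, p4⟩ := ihl hl i
    obtain ⟨q1, q2, q3, q4⟩ := ihr hr (i - l.sz - 1)
    have hlen := hl.length_inorder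
    by_cases c1 : i < l.sz
    · simp [setAt, WF, *]
    by_cases c2 : l.sz < i
    · obtain ⟨m, rfl⟩ : ∃ m, i = l.inorder.length + (m + 1) := ⟨i - l.sz - 1, by omega⟩
      have : l.inorder.length + (m + 1) - l.sz - 1 = m := by omega
      rw [this] at q1 q2 q3 q4
      simp only [setAt, call_val, lt_bind, tick, subN, Run.bind_val, step_val, if_neg c1,
          if_pos c2, this, q4, inorder_node, WF, q1, q2, q3]
      simp [hl, h1, h2]
    · obtain rfl : i = l.sz := by omega
      simp [setAt, WF, hl, hr, h1, h2, hlen]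

theorem setAt_cost {t : AVL β} (h : t.WF) (i : ℕ) (x : β) :
    (setAt t i x).time ≤ 7 * (t.ht + 1) ∧ (setAt t i x).net = 0 ∧
      (setAt t i x).peak ≤ t.ht := by
  induction t generalizing i with
  | nil => simp [setAt]
  | node l a r k s ihl ihr =>
    obtain ⟨hl, hr, rfl, rfl, h1, h2⟩ := h
    obtain ⟨p1, p2, p3⟩ := ihl hl i
    obtain ⟨q1, q2, q3⟩ := ihr hr (i - l.sz - 1)
    simp only [setAt, call_time, call_net, ht_node]
    by_cases c1 : i < l.sz
    · refine ⟨?_, ?_, call_peak_le _ ?_ ?_⟩ <;> simp [c1] <;> omega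
    by_cases c2 : l.sz < i
    · refine ⟨?_, ?_, call_peak_le _ ?_ ?_⟩ <;> simp [c1, c2] <;> omega
    · refine ⟨?_, ?_, call_peak_le _ ?_ ?_⟩ <;> simp [c1, c2]
      omega

/-- Cost of a binary search with an elementary test. -/
theorem search_spec {p : β → Bool} {t : AVL β} (h : t.WF) (acc : ℕ) :
    (search (fun a => step (p a)) t acc).val ≤ acc + t.sz ∧
      (search (fun a => step (p a)) t acc).time ≤ 4 * (t.ht + 1) ∧
      (search (fun a => step (p a)) t acc).net = 0 ∧
      (search (fun a => step (p a)) t acc).peak = 0 := by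
  induction t generalizing acc with
  | nil => simp [search]
  | node l a r k s ihl ihr =>
    obtain ⟨hl, hr, rfl, rfl, h1, h2⟩ := h
    obtain ⟨p1, p2, p3, p4⟩ := ihl hl acc
    obtain ⟨q1, q2, q3, q4⟩ := ihr hr (acc + l.sz + 1)
    cases hp : p a
    · simp [search, *]; omega
    · simp [search, *]; omega

/-- If the elements satisfying `p` come first, binary search counts them. -/
theorem search_val {p : β → Bool} {t : AVL β} (h : t.WF)
    (hp : t.inorder.Pairwise fun a b => p b → p a) (acc : ℕ) :
    (search (fun a => step (p a)) t acc).val = acc + t.inorder.countP p := by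
  induction t generalizing acc with
  | nil => simp [search]
  | node l a r k s ihl ihr =>
    obtain ⟨hl, hr, rfl, rfl, h1, h2⟩ := h
    simp only [inorder_node, List.pairwise_append, List.pairwise_cons, List.mem_cons,
      forall_eq_or_imp] at hp
    obtain ⟨p1, ⟨p2, p3⟩, p4⟩ := hp
    cases ha : p a
    · have : r.inorder.countP p = 0 := by
        rw [List.countP_eq_zero]
        intro b hb hpb
        rw [p2 b hb hpb] at ha
        cases ha
      simp [search, ha, ihl hl p1, this]
    · have : l.inorder.countP p = l.sz := by
        rw [← hl.length_inorder, List.countP_eq_length]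
        intro b hb
        exact (p4 b hb).1 ha
      simp [search, ha, ihr hr p3, this]
      omega

theorem toList_val (t : AVL β) (acc : List β) : (toList t acc).val = t.inorder ++ acc := by
  induction t generalizing acc with
  | nil => simp [toList]
  | node l a r k s ihl ihr => simp [toList, ihl, ihr]

theorem toList_cost {t : AVL β} (h : t.WF) (acc : List β) :
    (toList t acc).time ≤ 5 * t.sz + 1 ∧ (toList t acc).net = t.sz ∧
      (toList t acc).peak ≤ t.sz + t.ht := by
  induction t generalizing acc with
  | nil => simp [toList]
  | node l a r k s ihl ihr =>
    obtain ⟨hl, hr, rfl, rfl, h1, h2⟩ := h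
    obtain ⟨q1, q2, q3⟩ := ihr hr acc
    obtain ⟨p1, p2, p3⟩ := ihl hl (a :: (toList r acc).val)
    simp only [toList, call_time, call_net, ht_node, sz_node]
    have e : l.sz + r.sz + 1 + (max l.ht r.ht + 1) = (l.sz + r.sz + 1 + max l.ht r.ht) + 1 := by
      omega
    rw [e]
    refine ⟨?_, ?_, call_peak_le _ ?_ ?_⟩ <;> simp <;> omega

end AVL

/-! ### The inverted index -/

section index

variable {α : Type} [LinearOrder α]

/-- The list `L` maps distinct tokens of `P`, in ascending order, to arrays no longer than their
numbers of occurrences in `P`. -/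
structure IsIndex (P : List α) (L : List (α × Array ℕ)) : Prop where
  sorted : L.Pairwise fun e e' => e.1 < e'.1
  mem : ∀ e ∈ L, e.1 ∈ P
  size_le : ∀ e ∈ L, e.2.size ≤ P.count e.1

/-- Binary search returns the number of entries below `t`; the split identifies this number with the
index at which `t` is found or has to be inserted. -/
theorem exists_split_of_sorted {L : List (α × Array ℕ)} (hL : L.Pairwise fun e e' => e.1 < e'.1)
    (t : α) : ∃ L₁ L₂, L = L₁ ++ L₂ ∧ (∀ e ∈ L₁, e.1 < t) ∧ (∀ e ∈ L₂, t ≤ e.1) ∧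
      L.countP (fun e => decide (e.1 < t)) = L₁.length := by
  induction L with
  | nil => exact ⟨[], [], by simp⟩
  | cons a L ih =>
    rw [List.pairwise_cons] at hL
    by_cases ha : a.1 < t
    · obtain ⟨L₁, L₂, rfl, h1, h2, h3⟩ := ih hL.2
      refine ⟨a :: L₁, L₂, rfl, ?_, h2, ?_⟩
      · simpa [ha] using h1
      · simp [ha, h3]
    · have h2 : ∀ e ∈ a :: L, t ≤ e.1 := by
        intro e he
        rcases List.mem_cons.1 he with rfl | he
        · exact not_lt.1 ha
        · exact (not_lt.1 ha).trans (hL.1 e he).le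
      refine ⟨[], a :: L, rfl, by simp, h2, ?_⟩
      rw [List.length_nil, List.countP_eq_zero]
      intro e he
      simpa using h2 e he

theorem IsIndex.insert {P : List α} {L₁ L₂ : List (α × Array ℕ)} (h : IsIndex P (L₁ ++ L₂))
    {t : α} (h1 : ∀ e ∈ L₁, e.1 < t) (h2 : ∀ e ∈ L₂, t < e.1) (i : ℕ) :
    IsIndex (P ++ [t]) (L₁ ++ (t, #[i]) :: L₂) := by
  obtain ⟨hs, hm, hc⟩ := h
  simp only [List.pairwise_append, List.mem_append] at hs hm hc
  refine ⟨?_, ?_, ?_⟩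
  · simp only [List.pairwise_append, List.pairwise_cons, List.mem_cons, forall_eq_or_imp]
    exact ⟨hs.1, ⟨h2, hs.2.1⟩, fun e he => ⟨h1 e he, hs.2.2 e he⟩⟩
  · intro e he
    simp only [List.mem_append, List.mem_cons] at he ⊢
    rcases he with he | rfl | he
    · exact .inl (hm e (.inl he))
    · simp
    · exact .inl (hm e (.inr he))
  · intro e he
    simp only [List.mem_append, List.mem_cons] at he
    rw [List.count_append]
    rcases he with he | rfl | he
    · exact (hc e (.inl he)).trans (Nat.le_add_right _ _)
    · simp
    · exact (hc e (.inr he)).trans (Nat.le_add_right _ _)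

theorem IsIndex.push {P : List α} {L₁ L₂ : List (α × Array ℕ)} {t : α} {A : Array ℕ}
    (h : IsIndex P (L₁ ++ (t, A) :: L₂)) (i : ℕ) :
    IsIndex (P ++ [t]) (L₁ ++ (t, A.push i) :: L₂) := by
  obtain ⟨hs, hm, hc⟩ := h
  simp only [List.pairwise_append, List.pairwise_cons, List.mem_append, List.mem_cons,
    forall_eq_or_imp] at hs hm hc
  refine ⟨?_, ?_, ?_⟩
  · simp only [List.pairwise_append, List.pairwise_cons, List.mem_cons, forall_eq_or_imp]
    exact hs
  · intro e he
    simp only [List.mem_append, List.mem_cons] at he ⊢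
    rcases he with he | rfl | he
    · exact .inl (hm e (.inl he))
    · simp
    · exact .inl (hm e (.inr (.inr he)))
  · intro e he
    simp only [List.mem_append, List.mem_cons] at he
    rw [List.count_append]
    rcases he with he | rfl | he
    · exact (hc e (.inl he)).trans (Nat.le_add_right _ _)
    · have := hc (t, A) (.inr (.inl rfl))
      simpa using this
    · exact (hc e (.inr (.inr he))).trans (Nat.le_add_right _ _)

theorem addPosition_spec {P : List α} {map : PosMap α} (hw : map.WF) (h : IsIndex P map.inorder)
    (t : α) (i : ℕ) :
    (addPosition map t i).val.WF ∧ IsIndex (P ++ [t]) (addPosition map t i).val.inorder ∧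
      (addPosition map t i).val.sz ≤ map.sz + 1 ∧
      (addPosition map t i).time ≤ 45 * (map.ht + 1) ∧ (addPosition map t i).net ≤ 2 ∧
      (addPosition map t i).peak ≤ map.ht + 2 := by
  obtain ⟨L₁, L₂, hL, h1, h2, hk⟩ := exists_split_of_sorted h.sorted t
  obtain ⟨-, s2, s3, s4⟩ := AVL.search_spec (p := fun e : α × Array ℕ => decide (e.1 < t)) hw 0
  have s1 := AVL.search_val (p := fun e : α × Array ℕ => decide (e.1 < t)) hw
    (h.sorted.imp fun {a b} hab hb => by simpa using hab.trans (by simpa using hb)) 0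
  rw [hk, zero_add] at s1
  obtain ⟨g1, g2, g3, g4⟩ := AVL.get?_spec hw L₁.length
  rw [hL, List.getElem?_append_right le_rfl, Nat.sub_self] at g1
  -- A new entry is needed both when the search runs off the end and when it stops at a larger
  -- token.
  have insert_case : (∀ e ∈ L₂, t < e.1) →
      (AVL.insertAt map L₁.length (t, #[i])).val.WF ∧
      IsIndex (P ++ [t]) (AVL.insertAt map L₁.length (t, #[i])).val.inorder := by
    intro h2'
    obtain ⟨w, e, -⟩ := AVL.insertAt_spec hw L₁.length (t, #[i])
    refine ⟨w, ?_⟩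
    rw [e, hL]
    simpa using (hL ▸ h).insert h1 h2' i
  obtain ⟨c1, c2, c3⟩ := AVL.insertAt_cost hw L₁.length (t, #[i])
  have c4 := AVL.insertAt_sz hw L₁.length (t, #[i])
  -- Strips the initial search off the program for any continuation, with its known value
  -- `L₁.length` substituted.
  have hs : ∀ (f : ℕ → Run (PosMap α)),
      (AVL.search (fun e => lt e.1 t) map 0 >>= f).val = (f L₁.length).val ∧
      (AVL.search (fun e => lt e.1 t) map 0 >>= f).time ≤
        4 * (map.ht + 1) + (f L₁.length).time ∧
      (AVL.search (fun e => lt e.1 t) map 0 >>= f).net = (f L₁.length).net ∧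
      (AVL.search (fun e => lt e.1 t) map 0 >>= f).peak = (f L₁.length).peak := by
    intro f
    simp only [lt, Run.bind_val, Run.bind_time, Run.bind_net, Run.bind_peak, s1, s3, s4]
    refine ⟨trivial, ?_, ?_, ?_⟩ <;> omega
  unfold addPosition
  obtain ⟨e1, e2, e3, e4⟩ := hs _
  rw [e1, e3, e4]
  rcases L₂ with _ | ⟨⟨t', A⟩, L₂⟩
  · have g1' : (AVL.get? map L₁.length).val = none := by simpa using g1
    obtain ⟨i1, i2⟩ := insert_case (by simp)
    simp [g1', g3, g4] at e2 ⊢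
    refine ⟨i1, i2, ?_⟩
    omega
  · have g1' : (AVL.get? map L₁.length).val = some (t', A) := by simpa using g1
    by_cases ht : t' = t
    · subst ht
      obtain ⟨i1, i2, i3, i4⟩ := AVL.setAt_spec hw L₁.length (t', A.push i)
      obtain ⟨j1, j2, j3⟩ := AVL.setAt_cost hw L₁.length (t', A.push i)
      have hidx := (hL ▸ h).push i
      rw [hL] at i4
      simp [g1', g3, g4] at e2 i4 ⊢
      refine ⟨i1, i4 ▸ hidx, ?_⟩
      omega
    · have h2' : ∀ e ∈ (t', A) :: L₂, t < e.1 := by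
        have ht' : t < t' := lt_of_le_of_ne (h2 (t', A) (by simp)) (Ne.symm ht)
        have hs := h.sorted
        rw [hL] at hs
        simp only [List.pairwise_append, List.pairwise_cons] at hs
        intro e he
        rcases List.mem_cons.1 he with rfl | he
        · exact ht'
        · exact ht'.trans (hs.2.1.1 e he)
      obtain ⟨i1, i2⟩ := insert_case h2'
      simp [g1', g3, g4, ht] at e2 ⊢
      refine ⟨i1, i2, ?_⟩
      omega

theorem buildMap_spec (T : List α) {M : ℕ} (hM : T.length + 1 ≤ M) :
    IsIndex T (buildMap T).val ∧ (buildMap T).val.length ≤ T.length ∧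
      (buildMap T).time ≤ (T.length + 1) * (100 * (Nat.log 2 M + 1)) ∧
      (buildMap T).net ≤ 3 * T.length ∧ (buildMap T).peak ≤ 4 * T.length + 2 := by
  obtain ⟨X, hX⟩ : ∃ X, X = 100 * (Nat.log 2 M + 1) := ⟨_, rfl⟩
  have loop := forList_induction (l := T) (s := ((AVL.nil : PosMap α), 1))
    (f := fun t (x : PosMap α × ℕ) =>
      match x with
      | (map, i) => do
        let map' ← addPosition map t i
        let i' ← addN i 1
        return (map', i'))
    -- Six steps per processed token are held in reserve to pay for reading out the tree afterwards.
    -- Two cells per token cover a tree node and an array entry.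
    (fun l s t u => ∃ P, T = P ++ l ∧ s.1.WF ∧ IsIndex P s.1.inorder ∧ s.1.sz ≤ P.length ∧
      t + 6 * P.length ≤ P.length * X ∧ u ≤ 2 * P.length) (3 * T.length + 2)
    ⟨[], by simp, by simp, ⟨by simp, by simp, by simp⟩, by simp, by simp, by simp⟩
    (by
      rintro s t u ⟨P, rfl, -, -, -, -, h⟩
      simp at h ⊢; omega)
    (by
      rintro a l ⟨map, i⟩ t u ⟨P, rfl, hw, hP, hsz, ht, hu⟩
      simp only at hw hP hsz ht hu
      obtain ⟨a1, a2, a3, a4, a5, a6⟩ := addPosition_spec hw hP a i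
      have hlog := hw.ht_le_log (M := M) (by simp at hM; omega)
      have hle := hw.ht_le_sz
      refine ⟨⟨P ++ [a], by simp, ?_, ?_, ?_, ?_, ?_⟩, ?_⟩
      · simpa using a1
      · simpa using a2
      · simp; omega
      · simp [Nat.succ_mul]; omega
      · simp; omega
      · simp; omega)
  obtain ⟨t, h1, ⟨P, h2, hw, hP, hsz, ht, hu⟩, hp⟩ := loop
  obtain rfl : T = P := by simpa using h2
  unfold buildMap
  simp only [Run.bind_val, Run.bind_time, Run.bind_net, Run.bind_peak]
  generalize (forList T _ _ : Run (PosMap α × ℕ)) = R at *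
  obtain ⟨⟨map, i⟩, Rt, Rn, Rp⟩ := R
  simp only at *
  obtain ⟨l1, l2, l3⟩ := AVL.toList_cost hw []
  have hle := hw.ht_le_sz
  rw [AVL.toList_val, List.append_nil, hw.length_inorder, ← hX, Nat.succ_mul]
  refine ⟨hP, hsz, ?_, ?_, ?_⟩ <;> omega

end index

/-! ### Key generation -/

section generation

variable {α : Type}

open Classical in
/-- The number of active keys of a token `t` that occurs `m` times. -/
noncomputable def activeCount (h : α → ℕ → ℕ) (t : α) (m : ℕ) : ℕ :=
  ∑ x ∈ Finset.Ico 1 (m + 1), if IsActiveHash h t x then m + 1 - x else 0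

theorem activeCount_mono (h : α → ℕ → ℕ) (t : α) : Monotone (activeCount h t) := by
  intro m m' hm
  unfold activeCount
  refine (Finset.sum_le_sum fun x _ => ?_).trans
    (Finset.sum_le_sum_of_subset (Finset.Ico_subset_Ico_right (by omega : m + 1 ≤ m' + 1)))
  split_ifs <;> omega

/-- A loop that adds one element to a list in every round. -/
theorem forRange_cons_spec {β : Type} {f : ℕ → List β → Run (List β)} {c : ℕ}
    (hf : ∀ i K, (f i K).val.length = K.length + 1 ∧ (f i K).time ≤ c ∧ (f i K).net = 1 ∧
      (f i K).peak ≤ 1) (lo cnt : ℕ) (K : List β) :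
    (forRange lo cnt K f).val.length = K.length + cnt ∧
      (forRange lo cnt K f).time ≤ cnt * (c + 1) + 1 ∧ (forRange lo cnt K f).net = cnt ∧
      (forRange lo cnt K f).peak ≤ cnt := by
  obtain ⟨t, h1, ⟨j, h2, h3, h4, h5⟩, h6⟩ := forRange_induction (f := f) (lo := lo) (cnt := cnt)
    (s := K) (fun i s t u => ∃ j, i = lo + j ∧ s.length = K.length + j ∧ t ≤ j * (c + 1) ∧ u = j)
    cnt ⟨0, by simp⟩
    (by
      rintro s t u ⟨j, hj, -, -, rfl⟩
      omega)
    (by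
      rintro i s t u hi ⟨j, rfl, hs, ht, rfl⟩
      obtain ⟨f1, f2, f3, f4⟩ := hf (lo + j) s
      refine ⟨⟨j + 1, by omega, by omega, ?_, by omega⟩, by omega⟩
      rw [Nat.succ_mul]
      omega)
  obtain rfl : cnt = j := by omega
  exact ⟨h3, by omega, h5, h6⟩

/-- The body of the outer loop of `generateActiveKeys`. -/
def listActive (h : α → ℕ → ℕ) (t : α) (A : Array ℕ) (K : List HKey) : Run (List HKey) := do
  let (K, _) ← forRange 1 A.size (K, (⊤ : WithTop ℕ)) fun x (K, minkey) => do
    let v ← hash h t x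
    if ← lt (v : WithTop ℕ) minkey then
      let m ← addN A.size 1
      let cnt ← subN m x
      let K' ← forRange 0 cnt K fun i K => do
        let u ← addN i x
        let e ← subN u 1
        let p ← read A i
        let q ← read A e
        cons ⟨p, q, v⟩ K
      return (K', (v : WithTop ℕ))
    else
      return (K, minkey)
  return K

/-- The running minimum is at most every earlier value, so a successful test certifies an active
`x`, and the inner loop then adds `A.size + 1 - x` keys. The partial sums `G` of `activeCount`
therefore bound the keys listed so far. -/
theorem listActive_spec (h : α → ℕ → ℕ) (t : α) (A : Array ℕ) (K : List HKey) :
    (listActive h t A K).val.length ≤ K.length + activeCount h t A.size ∧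
      (listActive h t A K).time ≤ 6 * A.size + 7 * activeCount h t A.size + 1 ∧
      (listActive h t A K).net ≤ activeCount h t A.size ∧
      (listActive h t A K).peak ≤ activeCount h t A.size := by
  classical
  obtain ⟨g, hg⟩ : ∃ g : ℕ → ℕ, g = fun x => if IsActiveHash h t x then A.size + 1 - x else 0 :=
    ⟨_, rfl⟩
  obtain ⟨G, hG⟩ : ∃ G : ℕ → ℕ, G = fun x => ∑ y ∈ Finset.Ico 1 x, g y := ⟨_, rfl⟩
  have hcount : activeCount h t A.size = G (1 + A.size) := by
    rw [activeCount, hG, hg, add_comm 1]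
  unfold listActive
  rw [hcount]
  obtain ⟨τ, r1, ⟨-, -, r2, r3, r4⟩, r5⟩ := forRange_induction
    (f := fun x (s : List HKey × WithTop ℕ) => match s with
      | (K, minkey) => do
        let v ← hash h t x
        if ← lt (v : WithTop ℕ) minkey then
          let m ← addN A.size 1
          let cnt ← subN m x
          let K' ← forRange 0 cnt K fun i K => do
            let u ← addN i x
            let e ← subN u 1
            let p ← read A i
            let q ← read A e
            cons ⟨p, q, v⟩ K
          return (K', (v : WithTop ℕ))
        else
          return (K, minkey))
    (lo := 1) (cnt := A.size) (s := (K, (⊤ : WithTop ℕ)))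
    (fun x s τ u => 1 ≤ x ∧ (∀ x', 1 ≤ x' → x' < x → s.2 ≤ (h t x' : WithTop ℕ)) ∧
      s.1.length ≤ K.length + G x ∧
      τ ≤ 6 * (x - 1) + 7 * G x ∧ u ≤ G x)
    (G (1 + A.size))
    ⟨le_rfl, fun x' h1 h2 => by omega, by simp [hG], by simp [hG], by simp [hG]⟩
    (fun s τ u H => H.2.2.2.2)
    (by
      rintro x ⟨K', minkey⟩ τ u hx ⟨hx1, hmin, hlen, hτ, hu⟩
      simp only at hmin hlen hτ hu
      have hsum : G (x + 1) = G x + g x := by rw [hG]; exact Finset.sum_Ico_succ_top hx1 g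
      have hle : G (x + 1) ≤ G (1 + A.size) := by
        rw [hG]
        exact Finset.sum_le_sum_of_subset (Finset.Ico_subset_Ico_right (by omega))
      by_cases hv : (h t x : WithTop ℕ) < minkey
      · have hact : IsActiveHash h t x := fun x' h1 h2 => by
          exact_mod_cast hv.trans_le (hmin x' h1 h2)
        have hgx : g x = A.size + 1 - x := by rw [hg]; exact if_pos hact
        obtain ⟨f1, f2, f3, f4⟩ := forRange_cons_spec (c := 6)
          (f := fun i K => do
            let u ← addN i x
            let e ← subN u 1
            let p ← read A i
            let q ← read A e
            cons ⟨p, q, h t x⟩ K)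
          (fun i K => by simp) 0 (A.size + 1 - x) K'
        simp only [lt_bind]
        simp [hv] at f1 f2 f3 f4 ⊢
        refine ⟨⟨?_, ?_, ?_, ?_⟩, ?_⟩
        · intro x' h1 h2
          rcases Nat.lt_or_eq_of_le h2 with h3 | rfl
          · exact (hact x' h1 h3).le
          · exact le_rfl
        all_goals omega
      · simp [hv]
        refine ⟨⟨?_, ?_, ?_, ?_⟩, ?_⟩
        · intro x' h1 h2
          rcases Nat.lt_or_eq_of_le h2 with h3 | rfl
          · exact hmin x' h1 h3
          · exact not_lt.1 hv
        all_goals omega)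
  simp only [Run.bind_val, Run.bind_time, Run.bind_net, Run.bind_peak]
  generalize (forRange 1 A.size _ _ : Run (List HKey × WithTop ℕ)) = R at *
  obtain ⟨⟨K', mk⟩, Rt, Rn, Rp⟩ := R
  simp only [Run.pure_val, Run.pure_time, Run.pure_net, Run.pure_peak] at *
  refine ⟨r2, ?_, ?_, ?_⟩ <;> omega

/-- The body of the outer loop of `generateKeys`. -/
def listAll (h : α → ℕ → ℕ) (t : α) (A : Array ℕ) (K : List HKey) : Run (List HKey) :=
  forRange 0 A.size K fun i K => do
    let cnt ← subN A.size i
    forRange i cnt K fun j K => do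
      let p ← read A i
      let q ← read A j
      let m ← subN j i
      let x ← addN m 1
      let v ← hash h t x
      cons ⟨p, q, v⟩ K

/-- Each row of the triangle `i ≤ j` is charged as a full row of length `A.size`. -/
theorem listAll_spec (h : α → ℕ → ℕ) (t : α) (A : Array ℕ) (K : List HKey) :
    (listAll h t A K).val.length ≤ K.length + A.size * A.size ∧
      (listAll h t A K).time ≤ 6 * A.size + 8 * (A.size * A.size) + 1 ∧
      (listAll h t A K).net ≤ (A.size * A.size : ℕ) ∧
      (listAll h t A K).peak ≤ A.size * A.size := by
  unfold listAll
  obtain ⟨m, hm⟩ : ∃ m, m = A.size := ⟨_, rfl⟩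
  rw [← hm]
  obtain ⟨τ, r1, ⟨r2, r3, r4⟩, r5⟩ := forRange_induction
    (f := fun i K => do
      let cnt ← subN m i
      forRange i cnt K fun j K => do
        let p ← read A i
        let q ← read A j
        let m ← subN j i
        let x ← addN m 1
        let v ← hash h t x
        cons ⟨p, q, v⟩ K)
    (lo := 0) (cnt := m) (s := K)
    (fun i s τ u => s.length ≤ K.length + i * m ∧ τ ≤ i * (8 * m + 3) ∧ u ≤ (i * m : ℕ))
    (m * m)
    (by simp) (fun s τ u H => by simpa using H.2.2)
    (by
      rintro i K' τ u hi ⟨hlen, hτ, hu⟩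
      obtain ⟨f1, f2, f3, f4⟩ := forRange_cons_spec (c := 7)
        (f := fun j K => do
          let p ← read A i
          let q ← read A j
          let m ← subN j i
          let x ← addN m 1
          let v ← hash h t x
          cons ⟨p, q, v⟩ K)
        (fun i K => by simp) i (m - i) K'
      have hle : (i + 1) * m ≤ m * m := Nat.mul_le_mul_right _ (by omega)
      have e1 : (i + 1) * m = i * m + m := by ring
      have e2 : (i + 1) * (8 * m + 3) = i * (8 * m + 3) + (8 * m + 3) := by ring
      rw [e1] at hle
      rw [e1, e2]
      simp only [subN, Run.bind_val, Run.bind_time, Run.bind_net, Run.bind_peak, step_val,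
        step_time, step_net, step_peak] at f1 f2 f3 f4 ⊢
      refine ⟨⟨?_, ?_, ?_⟩, ?_⟩ <;> omega)
  rw [zero_add] at r2 r3 r4
  refine ⟨r2, ?_, r4, r5⟩
  rw [r1]
  nlinarith

variable [LinearOrder α]

/-- An index bounds array sizes by token counts only from above, which is why `g` has to be
monotone; sortedness makes the tokens distinct, so none is counted twice. -/
theorem IsIndex.sum_le {T : List α} {E : List (α × Array ℕ)} (hE : IsIndex T E)
    (g : α → ℕ → ℕ) (hg : ∀ t, Monotone (g t)) :
    (E.map fun e => g e.1 e.2.size).sum ≤ ∑ t ∈ T.toFinset, g t (T.count t) := by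
  have hnd : (E.map Prod.fst).Nodup := by
    rw [List.Nodup, List.pairwise_map]
    exact hE.sorted.imp fun h => h.ne
  calc (E.map fun e => g e.1 e.2.size).sum
      ≤ (E.map fun e => g e.1 (T.count e.1)).sum :=
        List.sum_le_sum fun e he => hg _ (hE.size_le e he)
    _ = ((E.map Prod.fst).map fun t => g t (T.count t)).sum := by rw [List.map_map]; rfl
    _ = ∑ t ∈ (E.map Prod.fst).toFinset, g t (T.count t) := (List.sum_toFinset _ hnd).symm
    _ ≤ ∑ t ∈ T.toFinset, g t (T.count t) := by
        refine Finset.sum_le_sum_of_subset fun t ht => ?_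
        simp only [List.mem_toFinset, List.mem_map] at ht ⊢
        obtain ⟨e, he, rfl⟩ := ht
        exact hE.mem e he

theorem IsIndex.sum_size_le {T : List α} {E : List (α × Array ℕ)} (hE : IsIndex T E) :
    (E.map fun e => e.2.size).sum ≤ T.length :=
  (hE.sum_le (fun _ m => m) fun _ _ _ h => h).trans (List.sum_toFinset_count_eq_length T).le

/-- Iterating a procedure over the entries of an index. -/
theorem forList_entries_spec {T : List α} {E : List (α × Array ℕ)} (hE : IsIndex T E)
    (f : α × Array ℕ → List HKey → Run (List HKey)) (g : α → ℕ → ℕ) (hg : ∀ t, Monotone (g t))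
    {N : ℕ} (hN : ∑ t ∈ T.toFinset, g t (T.count t) ≤ N)
    (hf : ∀ e K, (f e K).val.length ≤ K.length + g e.1 e.2.size ∧
      (f e K).time ≤ 6 * e.2.size + 8 * g e.1 e.2.size + 1 ∧
      (f e K).net ≤ g e.1 e.2.size ∧ (f e K).peak ≤ g e.1 e.2.size) :
    (forList E [] f).val.length ≤ N ∧
      (forList E [] f).time ≤ 6 * T.length + 8 * N + 2 * E.length + 1 ∧
      (forList E [] f).net ≤ N ∧ (forList E [] f).peak ≤ N := by
  have hsum := (hE.sum_le g hg).trans hN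
  have hsize := hE.sum_size_le
  obtain ⟨τ, r1, ⟨E₁, r2, r3, r4, r5⟩, r6⟩ := forList_induction (f := f) (l := E) (s := [])
    (fun l s τ u => ∃ E₁, E = E₁ ++ l ∧
      s.length ≤ (E₁.map fun e => g e.1 e.2.size).sum ∧
      τ ≤ 6 * (E₁.map fun e => e.2.size).sum + 8 * (E₁.map fun e => g e.1 e.2.size).sum +
        2 * E₁.length ∧
      u ≤ ((E₁.map fun e => g e.1 e.2.size).sum : ℕ)) N
    ⟨[], by simp⟩
    (by
      rintro s τ u ⟨E₁, rfl, -, -, hu⟩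
      simp only [List.append_nil] at hsum
      omega)
    (by
      rintro e l s τ u ⟨E₁, rfl, hlen, hτ, hu⟩
      obtain ⟨f1, f2, f3, f4⟩ := hf e s
      simp only [List.map_append, List.sum_append, List.map_cons, List.sum_cons] at hsum
      refine ⟨⟨E₁ ++ [e], by simp, ?_, ?_, ?_⟩, by omega⟩
      all_goals
        simp only [List.map_append, List.sum_append, List.map_cons, List.sum_cons, List.map_nil,
          List.sum_nil, List.length_append, List.length_cons, List.length_nil]
        omega)
  obtain rfl : E = E₁ := by simpa using r2
  refine ⟨?_, ?_, ?_, r6⟩ <;> omega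

/-- Resource bounds for the generation of at most `N` keys from a text of `n` tokens. -/
structure KeyGenBounds (R : Run (List HKey)) (n N ℓ : ℕ) : Prop where
  length_le : R.val.length ≤ N
  time_le : R.time ≤ (n + 1) * (100 * ℓ) + (8 * n + 8 * N + 1)
  net_le : R.net ≤ 3 * n + N
  peak_le : R.peak ≤ 4 * n + N + 2

theorem generate_bounds (T : List α) (f : α × Array ℕ → List HKey → Run (List HKey))
    (g : α → ℕ → ℕ) (hg : ∀ t, Monotone (g t)) {M N : ℕ} (hM : T.length + 1 ≤ M)
    (hN : ∑ t ∈ T.toFinset, g t (T.count t) ≤ N)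
    (hf : ∀ e K, (f e K).val.length ≤ K.length + g e.1 e.2.size ∧
      (f e K).time ≤ 6 * e.2.size + 8 * g e.1 e.2.size + 1 ∧
      (f e K).net ≤ g e.1 e.2.size ∧ (f e K).peak ≤ g e.1 e.2.size) :
    KeyGenBounds (buildMap T >>= fun E => forList E [] f) T.length N (Nat.log 2 M + 1) := by
  obtain ⟨b1, b2, b3, b4, b5⟩ := buildMap_spec T hM
  obtain ⟨c1, c2, c3, c4⟩ := forList_entries_spec b1 f g hg hN hf
  constructor
  · exact c1
  all_goals
    simp only [Run.bind_time, Run.bind_net, Run.bind_peak]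
    omega

theorem generateActiveKeys_bounds (T : List α) (h : α → ℕ → ℕ) {M N : ℕ}
    (hM : T.length + 1 ≤ M) (hN : ∑ t ∈ T.toFinset, activeCount h t (T.count t) ≤ N) :
    KeyGenBounds (generateActiveKeys T h) T.length N (Nat.log 2 M + 1) :=
  generate_bounds T (fun e K => listActive h e.1 e.2 K) (activeCount h) (activeCount_mono h) hM hN
    fun e K => by
      obtain ⟨h1, h2, h3, h4⟩ := listActive_spec h e.1 e.2 K
      exact ⟨h1, by omega, h3, h4⟩

theorem generateKeys_bounds (T : List α) (h : α → ℕ → ℕ) {M N : ℕ}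
    (hM : T.length + 1 ≤ M) (hN : ∑ t ∈ T.toFinset, T.count t * T.count t ≤ N) :
    KeyGenBounds (generateKeys T h) T.length N (Nat.log 2 M + 1) :=
  generate_bounds T (fun e K => listAll h e.1 e.2 K) (fun _ m => m * m)
    (fun _ _ _ h => Nat.mul_le_mul h h) hM hN fun e K => listAll_spec h e.1 e.2 K

end generation

/-! ### Sorting the keys -/

theorem sortKeys_spec (K : List HKey) {M : ℕ} (hM : K.length + 1 ≤ M) :
    (sortKeys K).val.length = K.length ∧
      (sortKeys K).time ≤ K.length * (76 * (Nat.log 2 M + 1)) + 2 ∧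
      (sortKeys K).net = 2 * K.length ∧ (sortKeys K).peak ≤ 3 * K.length + 2 := by
  -- Search and insertion take 4 + 31 steps per level on at most `2 * Nat.log 2 M + 2` levels,
  -- giving 70; the other 6 cover the loop tick and the 5 steps reserved for `toList`.
  obtain ⟨X, hX⟩ : ∃ X, X = 76 * (Nat.log 2 M + 1) := ⟨_, rfl⟩
  obtain ⟨t, h1, ⟨j, h2, hw, hsz, ht, hu⟩, hp⟩ := forList_induction (l := K)
    (s := (AVL.nil : AVL HKey))
    (f := fun s t => do
      let k ← AVL.search (fun s' => le s'.v s.v) t 0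
      AVL.insertAt t k s)
    (fun l s t u => ∃ j, j + l.length = K.length ∧ s.WF ∧ s.sz = j ∧
      t + 5 * j ≤ j * X ∧ u = j) (2 * K.length + 2)
    ⟨0, by simp⟩
    (by
      rintro s t u ⟨j, hj, -, -, -, rfl⟩
      simp at hj; omega)
    (by
      rintro a l s t u ⟨j, hj, hw, hsz, ht, rfl⟩
      rw [List.length_cons] at hj
      obtain ⟨-, s2, s3, s4⟩ := AVL.search_spec (p := fun s' : HKey => decide (s'.v ≤ a.v)) hw 0
      have hlog := hw.ht_le_log (M := M) (by omega)
      have hle := hw.ht_le_sz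
      simp only [le, Run.bind_val, Run.bind_time, Run.bind_net, Run.bind_peak]
      obtain ⟨k, hk⟩ : ∃ k, k = (AVL.search (fun s' => step (decide (s'.v ≤ a.v))) s 0).val :=
        ⟨_, rfl⟩
      rw [← hk]
      obtain ⟨c1, c2, c3⟩ := AVL.insertAt_cost hw k a
      have c4 := AVL.insertAt_sz hw k a
      refine ⟨⟨j + 1, by omega, (AVL.insertAt_spec hw k a).1, by omega, ?_, ?_⟩, ?_⟩
      · rw [add_one_mul j X]; omega
      · push_cast; omega
      · omega)
  rw [List.length_nil, add_zero] at h2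
  subst h2
  unfold sortKeys
  simp only [Run.bind_val, Run.bind_time, Run.bind_net, Run.bind_peak]
  generalize (forList K _ _ : Run (AVL HKey)) = R at *
  obtain ⟨l1, l2, l3⟩ := AVL.toList_cost hw []
  have hle := hw.ht_le_sz
  rw [AVL.toList_val, List.append_nil, hw.length_inorder, ← hX]
  refine ⟨hsz, ?_, ?_, ?_⟩ <;> omega

/-! ### The main loop -/

theorem dominates_cost (s s' : ℕ × ℕ) :
    (dominates s s').time ≤ 4 ∧ (dominates s s').net = 0 ∧ (dominates s s').peak = 0 := by
  unfold dominates
  simp only [le_bind, eq_bind]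
  by_cases h1 : s'.1 ≤ s.1
  · by_cases h2 : s.2 ≤ s'.2
    · by_cases h3 : s.1 = s'.1
      · by_cases h4 : s.2 = s'.2 <;> simp [h2, h3, h4]
      · simp [h1, h2, h3]
    · simp [h1, h2]
  · simp [h1]

/-- The windows that `visit` outputs when it meets a key that is not dominated. -/
def emitWindows (key : HKey) (S : AVL (ℕ × ℕ)) (i len : ℕ) (P : List Window) :
    Run (List Window × ℕ) :=
  forRange i len (P, key.q) fun k (P, c') => do
    let sk ← AVL.get? S k
    let k' ← addN k 1
    let sk' ← AVL.get? S k'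
    let a ← addN (sk.getD (0, 0)).1 1
    let d ← subN (sk'.getD (0, 0)).2 1
    if ← le a key.p then
      if ← le c' d then
        let P' ← cons ⟨key.v, a, key.p, c', d⟩ P
        return (P', (sk'.getD (0, 0)).2)
      else
        return (P, (sk'.getD (0, 0)).2)
    else
      return (P, (sk'.getD (0, 0)).2)

theorem emitWindows_cost (key : HKey) {S : AVL (ℕ × ℕ)} (hS : S.WF) (i len : ℕ)
    (P : List Window) :
    (emitWindows key S i len P).time ≤ len * (10 * (S.ht + 1) + 8) + 1 ∧
      (emitWindows key S i len P).net ≤ len ∧ (emitWindows key S i len P).peak ≤ len := by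
  unfold emitWindows
  obtain ⟨X, hX⟩ : ∃ X, X = 10 * (S.ht + 1) + 8 := ⟨_, rfl⟩
  obtain ⟨t, h1, ⟨j, h2, ht, hu⟩, hp⟩ := forRange_induction (lo := i) (cnt := len)
    (s := (P, key.q))
    (f := fun k (x : List Window × ℕ) => match x with
      | (P, c') => do
        let sk ← AVL.get? S k
        let k' ← addN k 1
        let sk' ← AVL.get? S k'
        let a ← addN (sk.getD (0, 0)).1 1
        let d ← subN (sk'.getD (0, 0)).2 1
        if ← le a key.p then
          if ← le c' d then
            let P' ← cons ⟨key.v, a, key.p, c', d⟩ P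
            return (P', (sk'.getD (0, 0)).2)
          else
            return (P, (sk'.getD (0, 0)).2)
        else
          return (P, (sk'.getD (0, 0)).2))
    (fun k s t u => ∃ j, k = i + j ∧ t ≤ j * X ∧ u ≤ j) len
    ⟨0, by simp⟩
    (by
      rintro s t u ⟨j, hj, -, hu⟩
      omega)
    (by
      rintro k ⟨P, c'⟩ t u hk ⟨j, rfl, ht, hu⟩
      obtain ⟨-, g2, g3, g4⟩ := AVL.get?_spec hS (i + j)
      obtain ⟨-, g6, g7, g8⟩ := AVL.get?_spec hS (i + j + 1)
      -- All branches of the body share these three bounds, so the invariant is checked once for an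
      -- abstract run.
      suffices H : ∀ R : Run (List Window × ℕ), R.time + 1 ≤ X → R.net ≤ 1 → R.peak ≤ 1 →
          (∃ j', i + j + 1 = i + j' ∧ t + 1 + R.time ≤ j' * X ∧ u + R.net ≤ j') ∧
            u + R.peak ≤ len by
        simp only [le_bind]
        apply H
        all_goals
          simp only [addN, subN, tick, Run.bind_time, Run.bind_net, Run.bind_peak, step_val,
            step_time, step_net, step_peak, g3, g4, g7, g8]
          by_cases c1 : ((AVL.get? S (i + j)).val.getD (0, 0)).1 + 1 ≤ key.p
          · by_cases c2 : c' ≤ ((AVL.get? S (i + j + 1)).val.getD (0, 0)).2 - 1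
            · simp [c1, c2]; try omega
            · simp [c1, c2]; try omega
          · simp [c1]; try omega
      intro R r1 r2 r3
      refine ⟨⟨j + 1, by omega, ?_, by push_cast; omega⟩, by omega⟩
      rw [add_one_mul j X]; omega)
  obtain rfl : len = j := by omega
  rw [← hX]
  refine ⟨?_, hu, hp⟩
  omega

/-- The index stays fixed because later elements move down after each removal. The range condition
is guarded by `0 < rem`, since with truncated subtraction an empty range may begin beyond the end.
-/
theorem removeLoop_spec {β : Type} {S : AVL β} (hS : S.WF) {i rem : ℕ}
    (hi : 0 < rem → i + rem ≤ S.sz) {M : ℕ} (hM : S.sz + 1 ≤ M) (lo : ℕ) :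
    (forRange lo rem S fun _ S => AVL.removeAt S i).val.WF ∧
      (forRange lo rem S fun _ S => AVL.removeAt S i).val.sz + rem = S.sz ∧
      (forRange lo rem S fun _ S => AVL.removeAt S i).time ≤
        rem * (71 * (Nat.log 2 M + 1)) + 1 ∧
      (forRange lo rem S fun _ S => AVL.removeAt S i).net = -rem ∧
      (forRange lo rem S fun _ S => AVL.removeAt S i).peak ≤ S.sz + 1 := by
  obtain ⟨X, hX⟩ : ∃ X, X = 71 * (Nat.log 2 M + 1) := ⟨_, rfl⟩
  obtain ⟨t, h1, ⟨j, h2, hw, hsz, ht, hu⟩, hp⟩ := forRange_induction (lo := lo) (cnt := rem)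
    (s := S) (f := fun _ S => AVL.removeAt S i)
    (fun k s t u => ∃ j, k = lo + j ∧ s.WF ∧ s.sz + j = S.sz ∧ t ≤ j * X ∧ u = -j) (S.sz + 1)
    ⟨0, by simp [hS]⟩
    (by
      rintro s t u ⟨j, hj, -, -, -, hu⟩
      omega)
    (by
      rintro k s t u hk ⟨j, rfl, hw, hsz, ht, rfl⟩
      obtain ⟨w, e, -, -, -⟩ := AVL.removeAt_spec hw i
      obtain ⟨c1, c2, -, c3⟩ := AVL.removeAt_cost hw i
      have hlog := hw.ht_le_log (M := M) (by omega)
      have hle := hw.ht_le_sz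
      have hlt : i < s.sz := by omega
      have e' := e hlt
      have c2' := c2 hlt
      refine ⟨⟨j + 1, by omega, w, by omega, ?_, by push_cast; omega⟩, by push_cast; omega⟩
      rw [add_one_mul j X]; omega)
  obtain rfl : rem = j := by omega
  rw [← hX]
  exact ⟨hw, hsz, by omega, hu, hp⟩

theorem visit_eq (key : HKey) (S : AVL (ℕ × ℕ)) (P : List Window) :
    visit key S P = (do
      let cnt' ← AVL.search (fun s => le s.2 key.q) S 0
      let j' ← subN cnt' 1
      let sj ← AVL.get? S j'
      if ← dominates (sj.getD (0, 0)) (key.p, key.q) then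
        return (S, P)
      else
        let cnt ← AVL.search (fun s => lt s.2 key.q) S 0
        let i ← subN cnt 1
        let j ← AVL.search (fun s => le s.1 key.p) S 0
        let len ← subN j i
        let (P', _) ← emitWindows key S i len P
        let i' ← addN i 1
        let rem ← subN j i'
        let S' ← forRange i' rem S fun _ S => AVL.removeAt S i'
        let S'' ← AVL.insertAt S' i' (key.p, key.q)
        return (S'', P')) := rfl

/-- The amortized cost of one round, with the size of the skyline as the potential. -/
theorem visit_spec (key : HKey) {S : AVL (ℕ × ℕ)} (hS : S.WF) (P : List Window) {M X : ℕ}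
    (hM : S.sz + 2 ≤ M) (hX : X = 100 * (Nat.log 2 M + 1)) :
    (visit key S P).val.1.WF ∧ (visit key S P).val.1.sz ≤ S.sz + 1 ∧
      (visit key S P).time + (visit key S P).val.1.sz * X ≤ S.sz * X + 4 * X ∧
      (visit key S P).net ≤ 2 ∧ (visit key S P).peak ≤ 2 * S.sz + 4 := by
  obtain ⟨-, a2, a3, a4⟩ := AVL.search_spec (p := fun s : ℕ × ℕ => decide (s.2 ≤ key.q)) hS 0
  obtain ⟨-, b2, b3, b4⟩ := AVL.search_spec (p := fun s : ℕ × ℕ => decide (s.2 < key.q)) hS 0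
  obtain ⟨c1, c2, c3, c4⟩ := AVL.search_spec (p := fun s : ℕ × ℕ => decide (s.1 ≤ key.p)) hS 0
  have hlog := hS.ht_le_log (M := M) (by omega)
  have hle := hS.ht_le_sz
  rw [visit_eq]
  simp only [le, lt, Run.bind_val, Run.bind_time, Run.bind_net, Run.bind_peak, addN, subN,
    step_val, step_time, step_net, step_peak, a3, a4]
  generalize (AVL.search (fun s : ℕ × ℕ => step (decide (s.2 ≤ key.q))) S 0).val - 1 = j'
  obtain ⟨-, g2, g3, g4⟩ := AVL.get?_spec hS j'
  rw [g3, g4]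
  generalize (AVL.get? S j').val.getD (0, 0) = s
  obtain ⟨d1, d2, d3⟩ := dominates_cost s (key.p, key.q)
  rw [d2, d3]
  cases hd : (dominates s (key.p, key.q)).val
  · simp only [Bool.false_eq_true, if_false, Run.bind_val, Run.bind_time, Run.bind_net,
      Run.bind_peak, step_val, step_time, step_net, step_peak, Run.pure_val, Run.pure_time,
      Run.pure_net, Run.pure_peak, b3, b4, c3, c4]
    generalize (AVL.search (fun s : ℕ × ℕ => step (decide (s.2 < key.q))) S 0).val - 1 = i
    obtain ⟨j, hj⟩ : ∃ j, j = (AVL.search (fun s : ℕ × ℕ => step (decide (s.1 ≤ key.p))) S 0).val :=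
      ⟨_, rfl⟩
    rw [← hj] at c1 ⊢
    obtain ⟨e1, e2, e3⟩ := emitWindows_cost key hS i (j - i) P
    obtain ⟨r1, r2, r3, r4, r5⟩ := removeLoop_spec hS (i := i + 1) (rem := j - (i + 1))
      (by omega) (M := M) (by omega) (i + 1)
    generalize (forRange (i + 1) (j - (i + 1)) S fun _ S => AVL.removeAt S (i + 1)) = R at *
    have i1 := (AVL.insertAt_spec r1 (i + 1) (key.p, key.q)).1
    have i2 := AVL.insertAt_sz r1 (i + 1) (key.p, key.q)
    obtain ⟨i3, i4, i5⟩ := AVL.insertAt_cost r1 (i + 1) (key.p, key.q)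
    have rlog := r1.ht_le_log (M := M) (by omega)
    have rle := r1.ht_le_sz
    obtain ⟨len, hlen⟩ : ∃ len, len = j - i := ⟨_, rfl⟩
    obtain ⟨rem, hrem⟩ : ∃ rem, rem = j - (i + 1) := ⟨_, rfl⟩
    rw [← hlen] at e1 e2 e3 ⊢
    rw [← hrem] at r2 r3 r4
    -- The crux of the amortization: all candidate windows but one are matched with removed skyline
    -- elements.
    have hlr : len ≤ rem + 1 := by omega
    have hlsz : len ≤ S.sz := by omega
    have q1 : len * (10 * (S.ht + 1) + 8) ≤ (rem + 1) * (28 * (Nat.log 2 M + 1)) :=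
      Nat.mul_le_mul hlr (by omega)
    have q2 : S.sz * X = R.val.sz * X + rem * X := by rw [← r2, Nat.add_mul]
    -- The potential released by one removal pays for one window (28) and for the removal itself
    -- (71). The allowance `4 * X` in the goal covers the remaining window, the searches, the
    -- insertion and the potential of the inserted key.
    have q3 : rem * X = rem * (28 * (Nat.log 2 M + 1)) + rem * (71 * (Nat.log 2 M + 1)) +
        rem * (Nat.log 2 M + 1) := by rw [hX]; ring
    rw [add_one_mul rem] at q1
    refine ⟨i1, ?_, ?_, ?_, ?_⟩
    · omega
    · rw [i2, add_one_mul R.val.sz X]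
      omega
    · omega
    · omega
  · simp only [if_true, Run.pure_val, Run.pure_time, Run.pure_net, Run.pure_peak]
    refine ⟨hS, ?_, ?_, ?_, ?_⟩ <;> omega

/-! ### Monotonic partitioning -/

theorem mainLoop_spec (order : List HKey) {S : AVL (ℕ × ℕ)} (hS : S.WF) (hsz : S.sz = 2) {M X : ℕ}
    (hM : order.length + 4 ≤ M) (hX : X = 100 * (Nat.log 2 M + 1)) :
    (forList order (S, ([] : List Window)) fun key (S, P) => visit key S P).time ≤
        (order.length + 1) * (5 * X) ∧
      (forList order (S, ([] : List Window)) fun key (S, P) => visit key S P).net ≤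
        2 * order.length ∧
      (forList order (S, ([] : List Window)) fun key (S, P) => visit key S P).peak ≤
        4 * order.length + 8 := by
  obtain ⟨t, h1, ⟨j, h2, -, -, ht, hu⟩, hp⟩ := forList_induction (l := order)
    (s := (S, ([] : List Window)))
    (f := fun key (x : AVL (ℕ × ℕ) × List Window) => match x with | (S, P) => visit key S P)
    -- The potential starts at `2 * X` because of the two sentinels; a fifth `X` per round absorbs
    -- the loop tick.
    (fun l s t u => ∃ j, j + l.length = order.length ∧ s.1.WF ∧ s.1.sz ≤ j + 2 ∧
      t + s.1.sz * X ≤ j * (5 * X) + 2 * X ∧ u ≤ 2 * j) (4 * order.length + 8)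
    ⟨0, by simp [hS, hsz]⟩
    (by
      rintro s t u ⟨j, hj, -, -, -, hu⟩
      rw [List.length_nil] at hj
      omega)
    (by
      rintro key l ⟨S', P⟩ t u ⟨j, hj, hw, hs, ht, hu⟩
      simp only [List.length_cons] at hj hw hs ht ⊢
      obtain ⟨v1, v2, v3, v4, v5⟩ := visit_spec key hw P (M := M) (by omega) hX
      refine ⟨⟨j + 1, by omega, v1, by omega, ?_, by push_cast; omega⟩, by omega⟩
      rw [add_one_mul j (5 * X)]
      omega)
  rw [List.length_nil, add_zero] at h2
  subst h2
  refine ⟨?_, hu, hp⟩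
  rw [add_one_mul _ (5 * X)]
  omega

theorem monotonicPartitioning_bounds {α : Type}
    (gen : List α → (α → ℕ → ℕ) → Run (List HKey)) (T : List α) (h : α → ℕ → ℕ) {M N : ℕ}
    (hM : N + 4 ≤ M) (h1 : 1 ≤ T.length) (hTN : T.length ≤ N)
    (hgen : KeyGenBounds (gen T h) T.length N (Nat.log 2 M + 1)) :
    (monotonicPartitioning gen T h).time ≤ 2000 * (N * (Nat.log 2 M + 1)) ∧
      (monotonicPartitioning gen T h).peak ≤ 50 * N := by
  obtain ⟨g1, g2, g3, g4⟩ := hgen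
  obtain ⟨s1, s2, s3, s4⟩ := sortKeys_spec (gen T h).val (M := M) (by omega)
  have w0 := (AVL.insertAt_spec (AVL.wf_nil (β := ℕ × ℕ)) 0 (0, 0))
  have z0 := AVL.insertAt_sz (AVL.wf_nil (β := ℕ × ℕ)) 0 (0, 0)
  obtain ⟨a1, a2, a3⟩ := AVL.insertAt_cost (AVL.wf_nil (β := ℕ × ℕ)) 0 (0, 0)
  unfold monotonicPartitioning
  simp only [Run.bind_time, Run.bind_peak, addN, step_val, step_time,
    step_net, step_peak, alloc_time, alloc_net, alloc_peak]
  generalize AVL.insertAt AVL.nil 0 ((0, 0) : ℕ × ℕ) = R₀ at *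
  have w1 := (AVL.insertAt_spec w0.1 1 (T.length + 1, T.length + 1)).1
  have z1 := AVL.insertAt_sz w0.1 1 (T.length + 1, T.length + 1)
  obtain ⟨b1, b2, b3⟩ := AVL.insertAt_cost w0.1 1 (T.length + 1, T.length + 1)
  generalize AVL.insertAt R₀.val 1 (T.length + 1, T.length + 1) = R₁ at *
  obtain ⟨m1, m3, m2⟩ := mainLoop_spec (sortKeys (gen T h).val).val w1
    (by rw [z1, z0]; rfl) (M := M) (by omega) rfl
  rw [s1] at m1 m2 m3
  obtain ⟨ℓ, hℓ⟩ : ∃ ℓ, ℓ = Nat.log 2 M + 1 := ⟨_, rfl⟩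
  rw [← hℓ] at g2 s2 m1 ⊢
  have hℓ1 : 1 ≤ ℓ := by omega
  have p1 : (T.length + 1) * (100 * ℓ) ≤ 200 * (N * ℓ) :=
    (Nat.mul_le_mul_right _ (by omega : T.length + 1 ≤ 2 * N)).trans_eq (by ring)
  have p2 : (gen T h).val.length * (76 * ℓ) ≤ 76 * (N * ℓ) :=
    (Nat.mul_le_mul_right _ g1).trans_eq (by ring)
  have p3 : ((gen T h).val.length + 1) * (5 * (100 * ℓ)) ≤ 1000 * (N * ℓ) :=
    (Nat.mul_le_mul_right _ (by omega : (gen T h).val.length + 1 ≤ 2 * N)).trans_eq (by ring)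
  have p4 : N ≤ N * ℓ := Nat.le_mul_of_pos_right _ hℓ1
  have q0 := w0.2.2.2
  simp only [AVL.ht_nil] at q0 a1 a3
  -- With the product replaced by a variable, the remaining inequalities are linear.
  generalize N * ℓ = Y at *
  simp only [Run.pure_time, Run.pure_peak]
  generalize forList (sortKeys (gen T h).val).val (R₁.val, ([] : List Window)) _ = R₂ at *
  constructor
  · omega
  · omega

/-! ### Counting active keys -/

section counting

variable {α : Type} [LinearOrder α]

theorem exists_getElem?_count_take {T : List α} {t : α} {r : ℕ} (h : r < T.count t) :
    ∃ p, T[p]? = some t ∧ (T.take p).count t = r := by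
  induction T generalizing r with
  | nil => simp at h
  | cons a T ih =>
    by_cases ha : a = t
    · subst ha
      rcases r with _ | r
      · exact ⟨0, by simp⟩
      · obtain ⟨p, h1, h2⟩ := ih (r := r) (by simpa using h)
        exact ⟨p + 1, by simpa using h1, by simpa using h2⟩
    · obtain ⟨p, h1, h2⟩ := ih (r := r) (by simpa [List.count_cons, ha] using h)
      exact ⟨p + 1, by simpa using h1, by simpa [List.count_cons, ha] using h2⟩

theorem count_take_succ {T : List α} {t : α} {p : ℕ} (h : T[p]? = some t) :
    (T.take (p + 1)).count t = (T.take p).count t + 1 := by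
  rw [List.take_add_one, h]
  simp

theorem count_take_mono (T : List α) (t : α) : Monotone fun p => (T.take p).count t :=
  fun _ _ h => (List.take_sublist_take_left h).count_le t

theorem count_take_lt {T : List α} {t : α} {p p' : ℕ} (h : T[p]? = some t) (hp : p < p') :
    (T.take p).count t < (T.take p').count t := by
  have := count_take_mono T t (show p + 1 ≤ p' from hp)
  simp only [count_take_succ h] at this
  omega

theorem count_take_inj {T : List α} {t : α} {p p' : ℕ} (h : T[p]? = some t)
    (h' : T[p']? = some t) (hc : (T.take p).count t = (T.take p').count t) : p = p' := by
  rcases lt_trichotomy p p' with hp | hp | hp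
  · have := count_take_lt h hp; omega
  · exact hp
  · have := count_take_lt h' hp; omega

/-- The number of occurrences inside a key is a difference of ranks. Here `p` counts the tokens
before the slice, hence the 1-based start `p + 1`. -/
theorem count_slice {T : List α} {t : α} {p q : ℕ} (hpq : p ≤ q) :
    (T.take p).count t + (slice T (p + 1) q).count t = (T.take q).count t := by
  rw [slice, Nat.add_sub_cancel]
  conv_rhs => rw [← List.take_append_drop p (T.take q), List.count_append, List.take_take,
    min_eq_left hpq]

/-- A key is determined by its token `t`, its occurrence number `x` and the rank `r` of its first
endpoint, counted from 0; its last endpoint then has rank `r + x - 1`. Activity depends on `t` and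
`x` alone, and `r` has `T.count t + 1 - x` admissible values. -/
theorem card_activeKeys (T : List α) (h : α → ℕ → ℕ) :
    (activeKeys T h).card = ∑ t ∈ T.toFinset, activeCount h t (T.count t) := by
  classical
  have hsum : ∑ t ∈ T.toFinset, activeCount h t (T.count t) =
      (T.toFinset.sigma fun t =>
        ((Finset.Ico 1 (T.count t + 1)).filter fun x => IsActiveHash h t x).sigma
          fun x => Finset.range (T.count t + 1 - x)).card := by
    simp only [Finset.card_sigma, Finset.card_range, Finset.sum_filter]
    refine Finset.sum_congr rfl fun t _ => ?_
    rw [activeCount]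
  rw [hsum]
  -- `pos t r` is the 0-based position of the occurrence of `t` with rank `r`; the bijection adds 1
  -- to both endpoints.
  choose! pos hpos hrank using fun (t : α) (r : ℕ) (h : r < T.count t) =>
    exists_getElem?_count_take h
  symm
  refine Finset.card_bij (fun e _ => (pos e.1 e.2.2 + 1, pos e.1 (e.2.2 + e.2.1 - 1) + 1))
    ?_ ?_ ?_
  · rintro ⟨t, x, r⟩ he
    simp only [Finset.mem_sigma, Finset.mem_filter, Finset.mem_Ico, Finset.mem_range] at he
    obtain ⟨-, ⟨⟨hx1, hx2⟩, hact⟩, hr⟩ := he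
    have p1 := hpos t r (by omega)
    have p2 := hrank t r (by omega)
    have q1 := hpos t (r + x - 1) (by omega)
    have q2 := hrank t (r + x - 1) (by omega)
    have hpn := (List.getElem?_eq_some_iff.1 p1).1
    have hqn := (List.getElem?_eq_some_iff.1 q1).1
    have hpq : pos t r ≤ pos t (r + x - 1) := by
      by_contra hlt
      have := count_take_lt q1 (not_le.1 hlt)
      omega
    have hs := count_slice (T := T) (t := t) (p := pos t r) (q := pos t (r + x - 1) + 1) (by omega)
    rw [count_take_succ q1] at hs
    have hx : (slice T (pos t r + 1) (pos t (r + x - 1) + 1)).count t = x := by omega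
    simp only [activeKeys, Finset.mem_filter, Finset.mem_product, Finset.mem_Icc]
    refine ⟨by omega, ⟨by omega, by omega, by omega, by simp [p1, q1]⟩, t, by simp [q1], ?_⟩
    rw [hx]
    exact hact
  · rintro ⟨t, x, r⟩ he ⟨t', x', r'⟩ he' heq
    simp only [Finset.mem_sigma, Finset.mem_filter, Finset.mem_Ico, Finset.mem_range] at he he'
    obtain ⟨-, ⟨⟨hx1, hx2⟩, -⟩, hr⟩ := he
    obtain ⟨-, ⟨⟨hx1', hx2'⟩, -⟩, hr'⟩ := he'
    simp only [Prod.mk.injEq, Nat.add_right_cancel_iff] at heq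
    obtain ⟨e1, e2⟩ := heq
    have p1 := hpos t r (by omega)
    have p1' := hpos t' r' (by omega)
    obtain rfl : t = t' := by
      rw [e1, p1'] at p1
      exact (Option.some.inj p1).symm
    have p2 := hrank t r (by omega)
    have p2' := hrank t r' (by omega)
    have q2 := hrank t (r + x - 1) (by omega)
    have q2' := hrank t (r' + x' - 1) (by omega)
    rw [e1] at p2
    rw [e2] at q2
    obtain rfl : r = r' := by omega
    obtain rfl : x = x' := by omega
    rfl
  · rintro ⟨p, q⟩ hpq
    simp only [activeKeys, Finset.mem_filter, Finset.mem_product, Finset.mem_Icc] at hpq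
    obtain ⟨-, ⟨hp1, hpq, hqn, heq⟩, t, hq, hact⟩ := hpq
    rw [hq] at heq
    obtain ⟨p, rfl⟩ : ∃ p', p = p' + 1 := ⟨p - 1, by omega⟩
    obtain ⟨q, rfl⟩ : ∃ q', q = q' + 1 := ⟨q - 1, by omega⟩
    simp only [Nat.add_sub_cancel] at heq hq
    have hs := count_slice (T := T) (t := t) (p := p) (q := q + 1) (by omega)
    have hsucc := count_take_succ hq
    have hle : (T.take p).count t ≤ (T.take q).count t := count_take_mono T t (by omega)
    have htot : (T.take (q + 1)).count t ≤ T.count t := (List.take_sublist _ _).count_le t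
    obtain ⟨x, hx⟩ : ∃ x, x = (slice T (p + 1) (q + 1)).count t := ⟨_, rfl⟩
    rw [← hx] at hs hact
    refine ⟨⟨t, x, (T.take p).count t⟩, ?_, ?_⟩
    · simp only [Finset.mem_sigma, Finset.mem_filter, Finset.mem_Ico, Finset.mem_range,
        List.mem_toFinset]
      exact ⟨List.mem_of_getElem? hq, ⟨⟨by omega, by omega⟩, hact⟩, by omega⟩
    · have i1 : (T.take p).count t < T.count t := by omega
      have i2 : (T.take p).count t + x - 1 < T.count t := by omega
      have e1 := count_take_inj (hpos t _ i1) heq (hrank t _ i1)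
      have e2 := count_take_inj (hpos t _ i2) hq ((hrank t _ i2).trans (by omega))
      simp only [e1, e2]

/-- `x = 1` is vacuously active, so every position gives a one-token active key. This absorbs the
cost of the text and its index into |X(T)|. -/
theorem length_le_card_activeKeys (T : List α) (h : α → ℕ → ℕ) :
    T.length ≤ (activeKeys T h).card := by
  classical
  rw [card_activeKeys, ← List.sum_toFinset_count_eq_length]
  refine Finset.sum_le_sum fun t ht => ?_
  have hpos : 0 < T.count t := List.count_pos_iff.2 (List.mem_toFinset.1 ht)
  have h1 : IsActiveHash h t 1 := fun x' h1 h2 => by omega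
  calc T.count t = if IsActiveHash h t 1 then T.count t + 1 - 1 else 0 := by simp [h1]
    _ ≤ activeCount h t (T.count t) :=
      Finset.single_le_sum (s := Finset.Ico 1 (T.count t + 1)) (a := 1)
        (f := fun x => if IsActiveHash h t x then T.count t + 1 - x else 0)
        (fun _ _ => Nat.zero_le _) (Finset.mem_Ico.2 ⟨le_rfl, by omega⟩)

theorem card_activeKeys_le (T : List α) (h : α → ℕ → ℕ) :
    (activeKeys T h).card ≤ T.length ^ 2 := by
  classical
  refine (Finset.card_filter_le _ _).trans ?_
  simp [Finset.card_product, pow_two]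

theorem count_le_maxFreq {T : List α} {t : α} (ht : t ∈ T) : T.count t ≤ maxFreq T :=
  Finset.le_sup (f := fun t => T.count t) (List.mem_toFinset.2 ht)

theorem maxFreq_le_length (T : List α) : maxFreq T ≤ T.length :=
  Finset.sup_le fun _ _ => List.count_le_length

theorem one_le_maxFreq {T : List α} (hT : 1 ≤ T.length) : 1 ≤ maxFreq T := by
  obtain ⟨t, ht⟩ := List.exists_mem_of_length_pos hT
  exact (List.count_pos_iff.2 ht).trans_le (count_le_maxFreq ht)

theorem sum_count_sq_le (T : List α) :
    ∑ t ∈ T.toFinset, T.count t * T.count t ≤ T.length * maxFreq T := by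
  rw [← List.sum_toFinset_count_eq_length, Finset.sum_mul]
  exact Finset.sum_le_sum fun t ht =>
    Nat.mul_le_mul_left _ (count_le_maxFreq (List.mem_toFinset.1 ht))

end counting

/-! ### The expected number of active keys -/

section expectation

/-- Among `k` values of an exchangeable family, a given one is the unique minimum with probability
at most `1 / k`. -/
theorem measure_isMin_le {Ω : Type*} [MeasurableSpace Ω] {μ : Measure Ω} [IsProbabilityMeasure μ]
    {ι : Type} {V : Ω → ι → ℕ}
    (hV : ∀ σ : Equiv.Perm ι, IdentDistrib V (fun ω e => V ω (σ e)) μ μ)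
    {k : ℕ} {a : Fin k → ι} (ha : Function.Injective a) (i : Fin k) :
    NullMeasurableSet {ω | ∀ j, j ≠ i → V ω (a i) < V ω (a j)} μ ∧
      k * μ {ω | ∀ j, j ≠ i → V ω (a i) < V ω (a j)} ≤ 1 := by
  classical
  let E : Fin k → Set (ι → ℕ) := fun i => {v | ∀ j, j ≠ i → v (a i) < v (a j)}
  have hE : ∀ i, MeasurableSet (E i) := fun i => by
    have : E i = ⋂ j, ⋂ _ : j ≠ i, {v | v (a i) < v (a j)} := by
      ext v; simp [E]
    rw [this]
    exact MeasurableSet.iInter fun j => MeasurableSet.iInter fun _ =>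
      measurableSet_lt (measurable_pi_apply _) (measurable_pi_apply _)
  -- Measurability is contained in the equality of laws, and only almost everywhere; hence
  -- null-measurable sets throughout.
  have hVm : AEMeasurable V μ := (hV 1).aemeasurable_fst
  have hnull : ∀ i, NullMeasurableSet (V ⁻¹' E i) μ := fun i =>
    hVm.nullMeasurableSet_preimage (hE i)
  have heq : ∀ i', μ (V ⁻¹' E i') = μ (V ⁻¹' E i) := fun i' => by
    -- Transposing the two arguments preserves the law and exchanges the roles of `i` and `i'`, so
    -- all the minimum events are equally likely.
    rw [(hV (Equiv.swap (a i) (a i'))).measure_mem_eq (hE i)]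
    congr 1
    ext ω
    simp only [E, Set.mem_preimage, Set.mem_ofPred_eq, ha.swap_apply, Equiv.swap_apply_left]
    constructor
    · intro h j hj
      refine h _ fun h' => hj ?_
      exact (Equiv.swap i i').injective (h'.trans (Equiv.swap_apply_left i i').symm)
    · intro h j hj
      have := h (Equiv.swap i i' j) fun h' => hj ?_
      · rwa [Equiv.swap_apply_self] at this
      · exact (Equiv.swap i i').injective (h'.trans (Equiv.swap_apply_right i i').symm)
  refine ⟨hnull i, ?_⟩
  -- Two indices cannot both attain a strict minimum.
  have hdisj : Pairwise (Function.onFun (AEDisjoint μ) fun i => V ⁻¹' E i) := fun i j hij => by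
    refine Disjoint.aedisjoint (Set.disjoint_left.2 fun ω h1 h2 => ?_)
    exact lt_asymm (h1 j hij.symm) (h2 i hij)
  calc k * μ (V ⁻¹' E i) = ∑ i', μ (V ⁻¹' E i') := by simp [heq]
    _ = μ (⋃ i', V ⁻¹' E i') := by rw [measure_iUnion₀ hdisj hnull, tsum_fintype]
    _ ≤ 1 := prob_le_one

variable {α : Type} [LinearOrder α]

/-- Activity of `x` means that the last of the arguments `(t, 1), …, (t, x)` carries the strict
minimum; the index `j : Fin x` stands for `(t, j + 1)`. -/
theorem IsRandomHash.measure_active_le {Ω : Type*} [MeasurableSpace Ω] {μ : Measure Ω}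
    [IsProbabilityMeasure μ] {T : List α} {H : Ω → α → ℕ → ℕ} (hH : IsRandomHash μ T H)
    {t : α} (ht : t ∈ T) {x : ℕ} (hx : 1 ≤ x) (hx' : x ≤ T.count t) :
    NullMeasurableSet {ω | IsActiveHash (H ω) t x} μ ∧
      x * μ {ω | IsActiveHash (H ω) t x} ≤ 1 := by
  let a : Fin x → hashArgs T := fun j =>
    ⟨(t, j + 1), ht, by simp, by have := j.isLt; simp; omega⟩
  have ha : Function.Injective a := fun i j hij => by
    have := congrArg (fun e : hashArgs T => e.1.2) hij
    simp only [a] at this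
    omega
  have hset : {ω | IsActiveHash (H ω) t x} = {ω | ∀ j, j ≠ ⟨x - 1, by omega⟩ →
      H ω (a ⟨x - 1, by omega⟩).1.1 (a ⟨x - 1, by omega⟩).1.2 < H ω (a j).1.1 (a j).1.2} := by
    ext ω
    simp only [IsActiveHash, Set.mem_ofPred_eq, a, Nat.sub_add_cancel hx]
    constructor
    · intro h j hj
      have := j.isLt
      refine h _ (by omega) ?_
      have : (j : ℕ) ≠ x - 1 := fun h' => hj (Fin.ext h')
      omega
    · intro h y h1 h2
      have := h ⟨y - 1, by omega⟩ (by rw [Ne, Fin.mk.injEq]; omega)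
      simpa only [Nat.sub_add_cancel h1] using this
  rw [hset]
  exact measure_isMin_le hH.exchangeable ha ⟨x - 1, by omega⟩

theorem sum_Ico_mul_inv_le (m : ℕ) :
    ∑ x ∈ Finset.Ico 1 (m + 1), (m : ℝ) * (x : ℝ)⁻¹ ≤ m * (1 + Real.log m) := by
  rw [← Finset.mul_sum]
  refine mul_le_mul_of_nonneg_left ?_ (Nat.cast_nonneg m)
  have h := harmonic_le_one_add_log m
  rw [harmonic_eq_sum_Icc] at h
  push_cast at h
  exact h

/-- By linearity, with the weight `m + 1 - x` bounded by `m` and the probability by `1 / x`; the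
harmonic sum supplies the logarithm. -/
theorem IsRandomHash.lintegral_activeCount_le {Ω : Type*} [MeasurableSpace Ω] {μ : Measure Ω}
    [IsProbabilityMeasure μ] {T : List α} {H : Ω → α → ℕ → ℕ} (hH : IsRandomHash μ T H)
    {t : α} (ht : t ∈ T) :
    AEMeasurable (fun ω => (activeCount (H ω) t (T.count t) : ENNReal)) μ ∧
      ∫⁻ ω, (activeCount (H ω) t (T.count t) : ENNReal) ∂μ ≤
        ENNReal.ofReal (T.count t * (1 + Real.log (T.count t))) := by
  classical
  obtain ⟨m, hm⟩ : ∃ m, m = T.count t := ⟨_, rfl⟩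
  rw [← hm]
  have hrw : (fun ω => (activeCount (H ω) t m : ENNReal)) = fun ω =>
      ∑ x ∈ Finset.Ico 1 (m + 1),
        {ω | IsActiveHash (H ω) t x}.indicator (fun _ => ((m + 1 - x : ℕ) : ENNReal)) ω := by
    ext ω
    rw [activeCount, Nat.cast_sum]
    refine Finset.sum_congr rfl fun x _ => ?_
    by_cases h : IsActiveHash (H ω) t x <;> simp [Set.indicator, h]
  have hx : ∀ x ∈ Finset.Ico 1 (m + 1), NullMeasurableSet {ω | IsActiveHash (H ω) t x} μ ∧
      x * μ {ω | IsActiveHash (H ω) t x} ≤ 1 := fun x hx => by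
    rw [Finset.mem_Ico] at hx
    exact hH.measure_active_le ht hx.1 (by omega)
  have hmeas : ∀ x ∈ Finset.Ico 1 (m + 1), AEMeasurable
      ({ω | IsActiveHash (H ω) t x}.indicator fun _ => ((m + 1 - x : ℕ) : ENNReal)) μ :=
    fun x h => aemeasurable_const.indicator₀ (hx x h).1
  rw [hrw]
  refine ⟨Finset.aemeasurable_fun_sum _ hmeas, ?_⟩
  rw [lintegral_finsetSum' _ hmeas]
  refine le_trans (Finset.sum_le_sum (g := fun x : ℕ => ENNReal.ofReal (m * (x : ℝ)⁻¹))
    fun x h => ?_) ?_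
  · have hpos : (0 : ℝ) < x := by
      rw [Finset.mem_Ico] at h
      exact_mod_cast h.1
    rw [lintegral_indicator_const₀ (hx x h).1, ENNReal.ofReal_mul (Nat.cast_nonneg m),
      ENNReal.ofReal_natCast, ENNReal.ofReal_inv_of_pos hpos, ENNReal.ofReal_natCast]
    refine mul_le_mul' ?_ ?_
    · rw [Finset.mem_Ico] at h
      exact_mod_cast (by omega : m + 1 - x ≤ m)
    · rw [ENNReal.le_inv_iff_mul_le, mul_comm]
      exact (hx x h).2
  · rw [← ENNReal.ofReal_sum_of_nonneg fun x _ => by positivity]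
    exact ENNReal.ofReal_le_ofReal (sum_Ico_mul_inv_le m)

theorem IsRandomHash.lintegral_card_activeKeys_le {Ω : Type*} [MeasurableSpace Ω] {μ : Measure Ω}
    [IsProbabilityMeasure μ] {T : List α} {H : Ω → α → ℕ → ℕ} (hH : IsRandomHash μ T H) :
    ∫⁻ ω, ((activeKeys T (H ω)).card : ENNReal) ∂μ ≤
      ENNReal.ofReal (T.length * (1 + Real.log (maxFreq T))) := by
  simp only [card_activeKeys, Nat.cast_sum]
  rw [lintegral_finsetSum' _ fun t ht =>
    (hH.lintegral_activeCount_le (List.mem_toFinset.1 ht)).1]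
  refine le_trans (Finset.sum_le_sum
    (g := fun t => ENNReal.ofReal (T.count t * (1 + Real.log (maxFreq T)))) fun t ht => ?_) ?_
  · have ht := List.mem_toFinset.1 ht
    refine (hH.lintegral_activeCount_le ht).2.trans (ENNReal.ofReal_le_ofReal ?_)
    have h1 : (0 : ℝ) < T.count t := by exact_mod_cast List.count_pos_iff.2 ht
    have h2 : (T.count t : ℝ) ≤ maxFreq T := by exact_mod_cast count_le_maxFreq ht
    gcongr
  · have h0 : 0 ≤ Real.log (maxFreq T : ℝ) := Real.log_natCast_nonneg _
    rw [← ENNReal.ofReal_sum_of_nonneg fun t _ => by positivity, ← Finset.sum_mul,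
      ← Nat.cast_sum, List.sum_toFinset_count_eq_length]

end expectation

/-! ### Logarithms -/

/-- Since `log 2 > 1/2`, the binary logarithm of `n ^ 4` is at most `8 log n`, and the extra 1 is at
most `2 log n`. -/
theorem natLog_pow_four_add_one_le {n : ℕ} (hn : 2 ≤ n) :
    ((Nat.log 2 (n ^ 4) + 1 : ℕ) : ℝ) ≤ 10 * Real.log n := by
  have h2 : (0.5 : ℝ) < Real.log 2 := by linarith [Real.log_two_gt_d9]
  have hlog : Real.log 2 ≤ Real.log n := Real.log_le_log (by norm_num) (by exact_mod_cast hn)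
  have h1 : (2 : ℝ) ^ Nat.log 2 (n ^ 4) ≤ (n : ℝ) ^ 4 := by
    exact_mod_cast Nat.pow_log_le_self 2 (pow_ne_zero 4 (by omega))
  have h3 := Real.log_le_log (by positivity) h1
  rw [Real.log_pow, Real.log_pow] at h3
  push_cast at h3 ⊢
  have h0 : (0 : ℝ) ≤ Nat.log 2 (n ^ 4) := Nat.cast_nonneg _
  nlinarith

/-! ### Bounds in terms of the text length and the number of keys -/

section bounds

theorem monotonicPartitioning_real_bounds {α : Type}
    (gen : List α → (α → ℕ → ℕ) → Run (List HKey)) (T : List α) (h : α → ℕ → ℕ) {N : ℕ}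
    (h2 : 2 ≤ T.length) (hTN : T.length ≤ N) (hN : N ≤ T.length ^ 2)
    (hgen : ∀ M, T.length + 1 ≤ M → KeyGenBounds (gen T h) T.length N (Nat.log 2 M + 1)) :
    ((monotonicPartitioning gen T h).time : ℝ) ≤ 20000 * (N * Real.log T.length) ∧
      ((monotonicPartitioning gen T h).peak : ℝ) ≤ 20000 * N := by
  -- `N ≤ n²` and `n ≥ 2` allow the choice `M = n ^ 4`, which turns `log N` into `O(log n)`.
  have hM : N + 4 ≤ T.length ^ 4 := by nlinarith
  obtain ⟨b1, b2⟩ := monotonicPartitioning_bounds gen T h hM (by omega) hTN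
    (hgen _ (by omega))
  have hlog := natLog_pow_four_add_one_le h2
  constructor
  · calc ((monotonicPartitioning gen T h).time : ℝ)
        ≤ 2000 * (N * ((Nat.log 2 (T.length ^ 4) + 1 : ℕ) : ℝ)) := by exact_mod_cast b1
      _ ≤ 2000 * (N * (10 * Real.log T.length)) := by gcongr
      _ = 20000 * (N * Real.log T.length) := by ring
  · calc ((monotonicPartitioning gen T h).peak : ℝ) ≤ 50 * N := by exact_mod_cast b2
      _ ≤ 20000 * N := by gcongr; norm_num

variable {α : Type} [LinearOrder α]

theorem monoActive_bounds (T : List α) (h : α → ℕ → ℕ) (h2 : 2 ≤ T.length) :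
    ((monoActive T h).time : ℝ) ≤ 20000 * ((activeKeys T h).card * Real.log T.length) ∧
      ((monoActive T h).peak : ℝ) ≤ 20000 * (activeKeys T h).card :=
  monotonicPartitioning_real_bounds _ T h h2 (length_le_card_activeKeys T h)
    (card_activeKeys_le T h) fun _ hM => generateActiveKeys_bounds T h hM (card_activeKeys T h).ge

theorem monoAll_bounds (T : List α) (h : α → ℕ → ℕ) (h2 : 2 ≤ T.length) :
    ((monoAll T h).time : ℝ) ≤ 20000 * (T.length * maxFreq T * Real.log T.length) ∧
      ((monoAll T h).peak : ℝ) ≤ 20000 * (T.length * maxFreq T) := by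
  have h1 := one_le_maxFreq (T := T) (by omega)
  have := monotonicPartitioning_real_bounds (N := T.length * maxFreq T) generateKeys T h h2
    (Nat.le_mul_of_pos_right _ h1)
    ((Nat.mul_le_mul_left _ (maxFreq_le_length T)).trans_eq (pow_two _).symm)
    fun _ hM => generateKeys_bounds T h hM (sum_count_sq_le T)
  rw [Nat.cast_mul] at this
  exact this

/-- Monotonicity of the lower integral needs no measurability of `g`, so the resource functions can
be inserted directly. -/
theorem IsRandomHash.lintegral_le_of_le_card {Ω : Type*} [MeasurableSpace Ω] {μ : Measure Ω}
    [IsProbabilityMeasure μ] {T : List α} {H : Ω → α → ℕ → ℕ} (hH : IsRandomHash μ T H)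
    {c : ℝ} (hc : 0 ≤ c) {g : Ω → ℕ}
    (hg : ∀ ω, (g ω : ℝ) ≤ c * (activeKeys T (H ω)).card) :
    ∫⁻ ω, (g ω : ENNReal) ∂μ ≤
      ENNReal.ofReal (c * (T.length * (1 + Real.log (maxFreq T)))) := by
  calc ∫⁻ ω, (g ω : ENNReal) ∂μ
      ≤ ∫⁻ ω, ENNReal.ofReal c * ((activeKeys T (H ω)).card : ENNReal) ∂μ := by
        refine lintegral_mono fun ω => ?_
        have := ENNReal.ofReal_le_ofReal (hg ω)
        rwa [ENNReal.ofReal_mul hc, ENNReal.ofReal_natCast, ENNReal.ofReal_natCast] at this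
    _ = ENNReal.ofReal c * ∫⁻ ω, ((activeKeys T (H ω)).card : ENNReal) ∂μ :=
        lintegral_const_mul' _ _ ENNReal.ofReal_ne_top
    _ ≤ ENNReal.ofReal c * ENNReal.ofReal (T.length * (1 + Real.log (maxFreq T))) := by
        gcongr
        exact hH.lintegral_card_activeKeys_le
    _ = _ := (ENNReal.ofReal_mul hc).symm

end bounds

end TextAlign

theorem theorem4 :
    ∃ C : ℝ, 0 < C ∧
      ∀ (α : Type) [LinearOrder α] (T : List α) (n f : ℕ),
        n = T.length → f = TextAlign.maxFreq T → 2 ≤ n →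
        -- every hash function, with the active keys only
        (∀ h : α → ℕ → ℕ,
          ((TextAlign.monoActive T h).time : ℝ) ≤
              C * ((TextAlign.activeKeys T h).card * Real.log n) ∧
          ((TextAlign.monoActive T h).peak : ℝ) ≤ C * (TextAlign.activeKeys T h).card) ∧
        -- a random hash function, in expectation
        (∀ (Ω : Type*) [MeasurableSpace Ω] (μ : MeasureTheory.Measure Ω)
          [MeasureTheory.IsProbabilityMeasure μ] (H : Ω → α → ℕ → ℕ),
          TextAlign.IsRandomHash μ T H →
          ∫⁻ ω, ((TextAlign.monoActive T (H ω)).time : ENNReal) ∂μ ≤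
              ENNReal.ofReal (C * (n * Real.log n + n * Real.log n * Real.log f)) ∧
          ∫⁻ ω, ((TextAlign.monoActive T (H ω)).peak : ENNReal) ∂μ ≤
              ENNReal.ofReal (C * (n + n * Real.log f))) ∧
        -- every hash function, with all the keys
        (∀ h : α → ℕ → ℕ,
          ((TextAlign.monoAll T h).time : ℝ) ≤ C * (n * f * Real.log n) ∧
          ((TextAlign.monoAll T h).peak : ℝ) ≤ C * (n * f)) := by
  refine ⟨20000, by norm_num, ?_⟩
  rintro α _ T n f rfl rfl hn
  refine ⟨fun h => TextAlign.monoActive_bounds T h hn, ?_,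
    fun h => TextAlign.monoAll_bounds T h hn⟩
  intro Ω _ μ _ H hH
  have hlog : 0 ≤ Real.log (T.length : ℝ) := Real.log_natCast_nonneg _
  constructor
  -- The factor `log n` does not depend on the hash function, so it belongs to the constant and only
  -- |X(T)| is averaged.
  · refine (hH.lintegral_le_of_le_card (c := 20000 * Real.log T.length) (by positivity)
      fun ω => ?_).trans_eq ?_
    · exact (TextAlign.monoActive_bounds T (H ω) hn).1.trans_eq (by ring)
    · congr 1; ring
  · refine (hH.lintegral_le_of_le_card (c := 20000) (by norm_num)
      fun ω => (TextAlign.monoActive_bounds T (H ω) hn).2).trans_eq ?_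
    congr 1; ring
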